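/- Let $r>0$. An oloid $\varOmega_r\subset\mathbb{R}^3$ is the convex hull of two circles of radius $r$ that lie in perpendicular planes and are such that the center of each circle lies on the other circle. The mean width $\bar b(C)$ of a nonempty compact set $C\subset\mathbb{R}^3$ is the average, with respect to the surface measure $\sigma$ on the unit sphere $S^2$, of its width: $$\bar b(C)=\frac1{4\pi}\int_{S^2}\big(h_C(w)+h_C(-w)\big)\,d\sigma(w),\qquad h_C(w)=\sup_{x\in C}\langle x,w\rangle .$$ Theorem. The mean width of every oloid $\varOmega_r$ is $$\bar b(\varOmega_r)=\Big(\frac{3}{2\pi}\,K\big(\sqrt3/2\big)+\frac{3\pi}{4}-\frac{2}{\pi}\,I\Big)\,r\approx 2.19067696623158876633263049436\,r ,$$ where $$K(k)=\int_0^{\pi/2}\frac{dx}{\sqrt{1-k^2\sin^2x}}\qquad\text{and}\qquad I=\int_0^{\pi/2}\arccos\frac{\cos x}{1+\cos x}\,dx ,$$ and where $\approx$ means that the decimal coefficient is correctly rounded, that is, $$\big|\bar b(\varOmega_r)-2.19067696623158876633263049436\,r\big|\le\tfrac12\cdot10^{-29}\,r .$$ -/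

import Mathlib

noncomputable section

/-- Three-dimensional Euclidean space with its standard scalar product. -/
abbrev E3 : Type := EuclideanSpace ℝ (Fin 3)

/-- The circle with center `c` and radius `r` in the plane through `c` with unit normal `n`. -/
def circleInPlane (c n : E3) (r : ℝ) : Set E3 :=
  {p | inner ℝ (p - c) n = 0 ∧ dist p c = r}

/-- `Ω` is an oloid of radius `r`: the convex hull of two circles of radius `r`, with centers
`A` and `B`, that lie in perpendicular planes (with unit normals `u` and `v`), the center of
each circle lying on the other circle. -/
def IsOloid (r : ℝ) (Ω : Set E3) : Prop :=
  ∃ A B u v : E3, ‖u‖ = 1 ∧ ‖v‖ = 1 ∧ inner ℝ u v = 0 ∧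
    B ∈ circleInPlane A u r ∧ A ∈ circleInPlane B v r ∧
    Ω = convexHull ℝ (circleInPlane A u r ∪ circleInPlane B v r)

/-- The support function of a (nonempty, bounded) set, `h_S(w) = sup {⟨x, w⟩ : x ∈ S}`. -/
def supportFn (S : Set E3) (w : E3) : ℝ :=
  sSup ((fun x : E3 => inner ℝ x w) '' S)

/-- The width of `S` in the direction of the unit vector `w`: the distance between the two
supporting planes of `S` that are orthogonal to `w`. -/
def widthIn (S : Set E3) (w : E3) : ℝ :=
  supportFn S w + supportFn S (-w)

/-- The mean width of `S`: the average of the width over all directions, with respect to the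
surface measure on the unit sphere. -/
def meanWidth (S : Set E3) : ℝ :=
  ⨍ w : Metric.sphere (0 : E3) 1, widthIn S (w : E3)
    ∂((MeasureTheory.volume : MeasureTheory.Measure E3).toSphere)

/-- The complete elliptic integral of the first kind with modulus `k`. -/
def ellipticK (k : ℝ) : ℝ :=
  ∫ x in (0 : ℝ)..(Real.pi / 2), 1 / Real.sqrt (1 - k ^ 2 * Real.sin x ^ 2)

/-- The integral `∫_0^{π/2} arccos (cos x / (1 + cos x)) dx`. -/
def oloidI : ℝ :=
  ∫ x in (0 : ℝ)..(Real.pi / 2), Real.arccos (Real.cos x / (1 + Real.cos x))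

end

open Real MeasureTheory intervalIntegral Set

namespace Oloid

/-! Let `e` be the unit vector from `A` to `B`. Up to the linear term `⟨A, w⟩`, which cancels in the
width, the support function is `r` times `unitSupport`: with `w = (z, x, y)` in the frame `(u, e,
v)`, the larger of `√(x² + y²)` and `x + √(x² + z²)`, one term per circle.

This function is homogeneous of degree one, so its sphere integral is twice its integral against
`exp (-‖w‖²)`, and the Gaussian integral may be computed in any cylindrical coordinates. Each term
is integrated, where it attains the maximum, about the normal of its own circle. The two regions
then have the same form `t² ≤ 1 - 2 cos φ` up to null sets, with integrands `1` and `1 - cos φ`.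
Integrating out `t` leaves `J = ∫ (2 + cos ψ) * capIntegral √(1 + 2 cos ψ)` over `[0, 2π/3]`, and
the mean width is `J r / π`.

To evaluate `J`, `amp` turns the root into `√3 cos x`; one integration by parts
(`hasDerivAt_boundaryTerm`) leaves `3/2 K` and the integral of `conjAngle`. The latter reduces to
`oloidI` because `conjAngle` inverts itself (`integral_conjAngle`).

The decimals come from series with explicit remainders: Wallis integrals for `K`, and for `oloidI`
the moments of `cos x / (1 + cos x)`, whose backward recursion also produces `π`. Everything is
evaluated by one integer Horner scheme with controlled rounding (`natHorner_bounds`). -/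

/-- `∫ cos² θ dθ` over the latitudes with `|tan θ| ≤ s`. -/
noncomputable def capIntegral (s : ℝ) : ℝ := arctan s + s / (1 + s ^ 2)

lemma continuous_capIntegral : Continuous capIntegral := by
  unfold capIntegral
  have : ∀ s : ℝ, 1 + s ^ 2 ≠ 0 := fun s => by positivity
  fun_prop (disch := assumption)

/-! ### The profile integral: elliptic substitution and integration by parts. -/

/-- Complementary modulus function at modulus `√3 / 2`. -/
noncomputable def delta (x : ℝ) : ℝ := √(1 - 3 / 4 * sin x ^ 2)

lemma delta_sq (x : ℝ) : delta x ^ 2 = 1 - 3 / 4 * sin x ^ 2 :=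
  sq_sqrt (by nlinarith [sin_sq_le_one x])

lemma delta_pos (x : ℝ) : 0 < delta x := sqrt_pos.2 (by nlinarith [sin_sq_le_one x])

lemma continuous_delta : Continuous delta := by unfold delta; fun_prop

lemma hasDerivAt_delta (x : ℝ) :
    HasDerivAt delta (-(3 / 4) * sin x * cos x / delta x) x := by
  have h : HasDerivAt (fun x => 1 - 3 / 4 * sin x ^ 2) (-(3 / 4 * (2 * sin x * cos x))) x := by
    have := (((hasDerivAt_sin x).pow 2).const_mul (3 / 4)).const_sub 1
    simpa using this
  have h2 := h.sqrt (by nlinarith [sin_sq_le_one x])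
  refine h2.congr_deriv ?_
  have := (delta_pos x).ne'
  change _ / (2 * delta x) = _
  field_simp

/-- The amplitude substitution `sin (ψ / 2) = √3 / 2 * sin x`. -/
noncomputable def amp (x : ℝ) : ℝ := 2 * arcsin (√3 / 2 * sin x)

lemma sq_sqrt_three : √3 ^ 2 = 3 := sq_sqrt (by norm_num)

lemma abs_sqrt_three_sin_lt (x : ℝ) : |√3 / 2 * sin x| < 1 := by
  rw [← sq_lt_one_iff_abs_lt_one]
  nlinarith [sin_sq_le_one x, sq_sqrt_three]

lemma sqrt_one_sub_eq_delta (x : ℝ) : √(1 - (√3 / 2 * sin x) ^ 2) = delta x := by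
  unfold delta
  congr 1
  nlinarith [sq_sqrt_three]

lemma hasDerivAt_amp (x : ℝ) : HasDerivAt amp (√3 * cos x / delta x) x := by
  have h := abs_lt.1 (abs_sqrt_three_sin_lt x)
  have := ((hasDerivAt_arcsin h.1.ne' h.2.ne).comp x
    ((hasDerivAt_sin x).const_mul (√3 / 2))).const_mul 2
  refine this.congr_deriv ?_
  rw [sqrt_one_sub_eq_delta]
  ring

lemma sin_half_amp (x : ℝ) : sin (arcsin (√3 / 2 * sin x)) = √3 / 2 * sin x := by
  have h := abs_lt.1 (abs_sqrt_three_sin_lt x)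
  exact sin_arcsin h.1.le h.2.le

lemma cos_amp (x : ℝ) : cos (amp x) = 1 - 3 / 2 * sin x ^ 2 := by
  rw [amp, cos_two_mul, cos_sq', sin_half_amp]
  linear_combination (-sin x ^ 2 / 2) * sq_sqrt_three

lemma amp_zero : amp 0 = 0 := by simp [amp]

lemma amp_pi_div_two : amp (π / 2) = 2 * π / 3 := by
  rw [amp, sin_pi_div_two, mul_one, ← sin_pi_div_three, arcsin_sin] <;> linarith [pi_pos]

lemma sqrt_one_add_two_cos_amp {x : ℝ} (hx : 0 ≤ cos x) :
    √(1 + 2 * cos (amp x)) = √3 * cos x := by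
  rw [cos_amp, sqrt_eq_iff_eq_sq (by nlinarith [sin_sq_le_one x]) (by positivity), mul_pow,
    sq_sqrt_three, cos_sq']
  ring

/-- The boundary term of the integration by parts. -/
noncomputable def boundaryTerm (x : ℝ) : ℝ :=
  √3 * (sin x * delta x * arctan (√3 * cos x)) + 3 / 4 * (sin x * cos x / delta x)

/-- With `ψ = amp x` one has `cos (ψ / 2) = delta x`, so the first term of `boundaryTerm` is `sin ψ
* arctan √(1 + 2 cos ψ)`, which integrates `cos ψ * arctan` by parts. The algebraic remainder is `Δ
+ 3 / (2 Δ) - 1 / (4 Δ³)` with `Δ = delta x`; the second term absorbs `Δ - 1 / (4 Δ³)`, so only a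
first-kind integrand survives. -/
lemma hasDerivAt_boundaryTerm {x : ℝ} (hx : 0 ≤ cos x) :
    HasDerivAt boundaryTerm
      ((2 + cos (amp x)) * capIntegral √(1 + 2 * cos (amp x)) * (√3 * cos x / delta x)
        - 2 * arctan √(1 + 2 * cos (amp x)) * (√3 * cos x / delta x) - 3 / 2 / delta x) x := by
  have hd := (delta_pos x).ne'
  have hD := hasDerivAt_delta x
  have hs := hasDerivAt_sin x
  have hc := hasDerivAt_cos x
  have ha : HasDerivAt (fun x => arctan (√3 * cos x)) (1 / (1 + (√3 * cos x) ^ 2) * (√3 * -sin x)) x :=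
    (hc.const_mul √3).arctan
  have h := (((hs.mul hD).mul ha).const_mul √3).add (((hs.mul hc).div hD hd).const_mul (3 / 4))
  refine h.congr_deriv ?_
  rw [sqrt_one_add_two_cos_amp hx, capIntegral, cos_amp]
  have e : 1 + (√3 * cos x) ^ 2 = 4 * delta x ^ 2 := by
    rw [mul_pow, sq_sqrt_three, delta_sq, cos_sq']; ring
  rw [e]
  have h3 := sq_sqrt_three
  have hC : cos x ^ 2 = 1 - sin x ^ 2 := cos_sq' x
  have hDD := delta_sq x
  simp only [Pi.mul_apply]
  generalize arctan (√3 * cos x) = T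
  generalize delta x = D at *
  generalize cos x = C at *
  generalize sin x = S at *
  field_simp
  ring_nf
  rw [show D ^ 4 = D ^ 2 * D ^ 2 by ring, h3, hC, hDD]
  ring

lemma integral_oloid_profile_substitution :
    ∫ ψ in (0 : ℝ)..(2 * π / 3), (2 + cos ψ) * capIntegral √(1 + 2 * cos ψ) =
      (∫ ψ in (0 : ℝ)..(2 * π / 3), 2 * arctan √(1 + 2 * cos ψ)) +
        3 / 2 * ∫ x in (0 : ℝ)..(π / 2), 1 / delta x := by
  have hcos : ∀ x ∈ uIcc 0 (π / 2), 0 ≤ cos x := by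
    intro x hx
    rw [uIcc_of_le (by positivity)] at hx
    exact cos_nonneg_of_neg_pi_div_two_le_of_le (by linarith [hx.1, pi_pos]) hx.2
  have hne : ∀ x, delta x ≠ 0 := fun x => (delta_pos x).ne'
  have hcd := continuous_delta
  have hca := continuous_capIntegral
  have hamp : Continuous amp := by unfold amp; fun_prop
  have hd' : Continuous fun x => √3 * cos x / delta x := by fun_prop (disch := assumption)
  have hsub : ∀ g : ℝ → ℝ, Continuous g →
      ∫ ψ in (0 : ℝ)..(2 * π / 3), g ψ =
        ∫ x in (0 : ℝ)..(π / 2), g (amp x) * (√3 * cos x / delta x) := by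
    intro g hg
    have := integral_comp_mul_deriv (a := 0) (b := π / 2) (f := amp) (g := g)
      (fun x _ => hasDerivAt_amp x) hd'.continuousOn hg
    rw [amp_zero, amp_pi_div_two] at this
    exact this.symm
  rw [hsub _ (by fun_prop), hsub _ (by fun_prop), ← intervalIntegral.integral_const_mul,
    ← sub_eq_zero, sub_add_eq_sub_sub, ← intervalIntegral.integral_sub,
    ← intervalIntegral.integral_sub]
  · have := integral_eq_sub_of_hasDerivAt (a := 0) (b := π / 2) (f := boundaryTerm)
      (fun x hx => hasDerivAt_boundaryTerm (hcos x hx))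
      (Continuous.intervalIntegrable (by fun_prop (disch := assumption)) _ _)
    -- Both ends contribute zero: `sin 0 = 0`, and `cos (π / 2) = 0` kills the arctangent as well.
    simp only [boundaryTerm, sin_zero, cos_pi_div_two] at this
    simp only [div_eq_mul_inv, one_mul] at this ⊢
    rw [this]
    simp
  all_goals exact Continuous.intervalIntegrable (by fun_prop (disch := assumption)) _ _

/-! ### The conjugate angle and the reduction to `oloidI`. -/

/-- The angle `α` with `(1 + cos α) * (1 + cos t) = 1`. -/
noncomputable def conjAngle (t : ℝ) : ℝ := 2 * arctan √(1 + 2 * cos t)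

lemma cos_conjAngle {t : ℝ} (ht : 0 ≤ cos t) :
    cos (conjAngle t) = -(cos t / (1 + cos t)) := by
  rw [conjAngle, cos_two_mul, cos_sq_arctan, sq_sqrt (by linarith)]
  field_simp
  ring

lemma conjAngle_eq {t : ℝ} (ht : 0 ≤ cos t) :
    conjAngle t = π - arccos (cos t / (1 + cos t)) := by
  rw [← arccos_neg, ← cos_conjAngle ht, arccos_cos]
  · unfold conjAngle
    have := arctan_nonneg.2 (sqrt_nonneg (1 + 2 * cos t))
    positivity
  · unfold conjAngle
    linarith [arctan_lt_pi_div_two √(1 + 2 * cos t)]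

/-- The relation `(1 + cos α) * (1 + cos t) = 1` is symmetric; concretely `1 + 2 cos α = tan (t / 2)
^ 2`. -/
lemma conjAngle_conjAngle {t : ℝ} (h0 : 0 ≤ t) (h1 : t ≤ π / 2) :
    conjAngle (conjAngle t) = t := by
  have hc : 0 ≤ cos t := cos_nonneg_of_neg_pi_div_two_le_of_le (by linarith) h1
  have hpi := pi_pos
  have hh : 0 < cos (t / 2) := cos_pos_of_mem_Ioo ⟨by linarith, by linarith⟩
  have ht : 0 ≤ tan (t / 2) := tan_nonneg_of_nonneg_of_le_pi_div_two (by linarith) (by linarith)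
  rw [conjAngle, cos_conjAngle hc]
  have e : 1 + 2 * -(cos t / (1 + cos t)) = tan (t / 2) ^ 2 := by
    have e1 : cos t = 2 * cos (t / 2) ^ 2 - 1 := by rw [← cos_two_mul]; ring_nf
    rw [tan_eq_sin_div_cos, div_pow, sin_sq, e1]
    field_simp
    ring
  rw [e, sqrt_sq ht, arctan_tan] <;> linarith

lemma continuous_conjAngle : Continuous conjAngle := by unfold conjAngle; fun_prop

lemma conjAngle_zero : conjAngle 0 = 2 * π / 3 := by
  have : √(1 + 2 * cos 0) = √3 := by norm_num
  rw [conjAngle, this, ← tan_pi_div_three, arctan_tan] <;> linarith [pi_pos]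

lemma conjAngle_pi_div_two : conjAngle (π / 2) = π / 2 := by
  simp [conjAngle]; ring

lemma hasDerivAt_conjAngle {t : ℝ} (ht : 0 ≤ cos t) :
    HasDerivAt conjAngle (-sin t / (√(1 + 2 * cos t) * (1 + cos t))) t := by
  have h0 : 0 < 1 + 2 * cos t := by linarith
  have h : HasDerivAt (fun t => 1 + 2 * cos t) (2 * -sin t) t :=
    ((hasDerivAt_cos t).const_mul 2).const_add 1
  have h2 := ((h.sqrt h0.ne').arctan).const_mul 2
  refine h2.congr_deriv ?_
  rw [sq_sqrt h0.le]
  have := sqrt_pos.2 h0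
  field_simp
  ring

/-- On `[π/2, 2π/3]` substitute `s = conjAngle t` with `t ∈ [0, π/2]`: the integrand becomes `t`,
and parts returns the integral over `[0, π/2]` minus `π² / 4`. Parametrising by `[0, π/2]` avoids
the endpoint `2π/3`, where the root vanishes and is not differentiable. -/
lemma integral_conjAngle :
    ∫ t in (0 : ℝ)..(2 * π / 3), conjAngle t = 3 * π ^ 2 / 4 - 2 * oloidI := by
  have hmem : ∀ x ∈ uIcc 0 (π / 2), 0 ≤ x ∧ x ≤ π / 2 ∧ 0 ≤ cos x := by
    intro x hx
    rw [uIcc_of_le (by positivity)] at hx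
    exact ⟨hx.1, hx.2, cos_nonneg_of_neg_pi_div_two_le_of_le (by linarith [hx.1, pi_pos]) hx.2⟩
  have hder : ∀ x ∈ uIcc 0 (π / 2), HasDerivAt conjAngle (-sin x / (√(1 + 2 * cos x) * (1 + cos x))) x :=
    fun x hx => hasDerivAt_conjAngle (hmem x hx).2.2
  have hcont : ContinuousOn (fun x => -sin x / (√(1 + 2 * cos x) * (1 + cos x))) (uIcc 0 (π / 2)) := by
    refine ContinuousOn.div (by fun_prop) (by fun_prop) fun x hx => ?_
    have := (hmem x hx).2.2
    positivity
  have hC := continuous_conjAngle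
  have hI : ∀ a b, IntervalIntegrable conjAngle volume a b := fun a b => hC.intervalIntegrable a b
  have h1 := integral_comp_mul_deriv hder hcont hC
  have h2 : ∫ x in (0 : ℝ)..(π / 2), (conjAngle ∘ conjAngle) x * (-sin x / (√(1 + 2 * cos x) * (1 + cos x)))
      = ∫ x in (0 : ℝ)..(π / 2), x * (-sin x / (√(1 + 2 * cos x) * (1 + cos x))) := by
    refine integral_congr fun x hx => ?_
    simp only [Function.comp, conjAngle_conjAngle (hmem x hx).1 (hmem x hx).2.1]
  have h3 := integral_mul_deriv_eq_deriv_mul (a := 0) (b := π / 2) (u := fun x => x) (u' := fun _ => 1)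
    (fun x _ => hasDerivAt_id x) hder (by simp) hcont.intervalIntegrable
  have h4 : ∫ x in (0 : ℝ)..(π / 2), conjAngle x = π ^ 2 / 2 - oloidI := by
    have : ∫ x in (0 : ℝ)..(π / 2), conjAngle x =
        ∫ x in (0 : ℝ)..(π / 2), (π - arccos (cos x / (1 + cos x))) :=
      integral_congr fun x hx => conjAngle_eq (hmem x hx).2.2
    rw [this, intervalIntegral.integral_sub (by simp), intervalIntegral.integral_const, oloidI]
    · simp; ring
    · refine ContinuousOn.intervalIntegrable (continuous_arccos.comp_continuousOn
        (ContinuousOn.div (by fun_prop) (by fun_prop) fun x hx => ?_))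
      have := (hmem x hx).2.2
      positivity
  rw [h2, h3, conjAngle_zero, conjAngle_pi_div_two] at h1
  simp only [one_mul, zero_mul, sub_zero, h4] at h1
  rw [← integral_add_adjacent_intervals (hI 0 (π / 2)) (hI (π / 2) _), h4,
    integral_symm, ← h1]
  ring

lemma integral_oloid_profile :
    ∫ ψ in (0 : ℝ)..(2 * π / 3), (2 + cos ψ) * capIntegral √(1 + 2 * cos ψ) =
      3 / 2 * ellipticK (√3 / 2) + 3 * π ^ 2 / 4 - 2 * oloidI := by
  have hK : ellipticK (√3 / 2) = ∫ x in (0 : ℝ)..(π / 2), 1 / delta x := by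
    have : (√3 / 2) ^ 2 = 3 / 4 := by rw [div_pow, sq_sqrt_three]; norm_num
    simp only [ellipticK, delta, this]
  rw [integral_oloid_profile_substitution, hK]
  have := integral_conjAngle
  simp only [conjAngle] at this
  rw [this]
  ring

/-! ### Series with explicit remainders for `1 / √(1 - y)`, `arcsin` and `K`. -/

/-- The Taylor coefficients of `1 / √(1 - y)`. -/
noncomputable def invSqrtCoeff (n : ℕ) : ℝ := (n.centralBinom : ℝ) / 4 ^ n

lemma invSqrtCoeff_zero : invSqrtCoeff 0 = 1 := by simp [invSqrtCoeff]

lemma invSqrtCoeff_succ (n : ℕ) :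
    invSqrtCoeff (n + 1) = (2 * n + 1) / (2 * n + 2) * invSqrtCoeff n := by
  have h : ((n : ℝ) + 1) * ((n + 1).centralBinom : ℝ) = 2 * (2 * n + 1) * (n.centralBinom : ℝ) := by
    exact_mod_cast Nat.succ_mul_centralBinom_succ n
  unfold invSqrtCoeff
  rw [pow_succ]
  field_simp
  linear_combination 2 * h

lemma invSqrtCoeff_nonneg (n : ℕ) : 0 ≤ invSqrtCoeff n := by unfold invSqrtCoeff; positivity

lemma invSqrtCoeff_le_one (n : ℕ) : invSqrtCoeff n ≤ 1 := by
  induction n with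
  | zero => simp [invSqrtCoeff]
  | succ n ih =>
    rw [invSqrtCoeff_succ]
    refine mul_le_one₀ ?_ (invSqrtCoeff_nonneg n) ih
    rw [div_le_one (by positivity)]
    linarith

/-- The Taylor polynomial of `1 / √(1 - y)` with `N` terms. -/
noncomputable def invSqrtPoly (N : ℕ) (y : ℝ) : ℝ :=
  ∑ n ∈ Finset.range N, invSqrtCoeff n * y ^ n

lemma continuous_invSqrtPoly (N : ℕ) : Continuous (invSqrtPoly N) := by
  unfold invSqrtPoly; fun_prop

/-- `1 / √(1 - y)` solves `(1 - y) f' = f / 2`; the truncated series misses this equation by a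
single monomial. -/
lemma hasDerivAt_invSqrtPoly (N : ℕ) (y : ℝ) :
    ∃ d, HasDerivAt (invSqrtPoly (N + 1)) d y ∧
      (1 - y) * d - invSqrtPoly (N + 1) y / 2 = -((N + 1) * invSqrtCoeff (N + 1) * y ^ N) := by
  induction N with
  | zero =>
    refine ⟨0, ?_, ?_⟩
    · have : invSqrtPoly 1 = fun _ => 1 := by
        funext y; simp [invSqrtPoly, invSqrtCoeff_zero]
      simpa [this] using hasDerivAt_const y (1 : ℝ)
    · simp [invSqrtPoly, invSqrtCoeff_succ, invSqrtCoeff_zero]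
  | succ N ih =>
    obtain ⟨d, hd, e⟩ := ih
    have hs : invSqrtPoly (N + 1 + 1) =
        fun y => invSqrtPoly (N + 1) y + invSqrtCoeff (N + 1) * y ^ (N + 1) := by
      funext y; simp [invSqrtPoly, Finset.sum_range_succ]
    refine ⟨d + invSqrtCoeff (N + 1) * ((N + 1 : ℕ) * y ^ N), ?_, ?_⟩
    · rw [hs]
      exact hd.add ((hasDerivAt_pow (N + 1) y).const_mul _)
    · rw [hs, invSqrtCoeff_succ (N + 1)]
      push_cast
      have : ((N : ℝ) + 1 + 1) * ((2 * (N + 1) + 1) / (2 * (N + 1) + 2) * invSqrtCoeff (N + 1))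
          = (2 * N + 3) / 2 * invSqrtCoeff (N + 1) := by
        field_simp; ring
      rw [this]
      linear_combination e

/-- By the defect equation `√(1 - y) P` decreases from `1`. Adding `y ^ N / √(1 - y)` makes it
increasing, since the coefficients are at most `1`. Divide both comparisons by `√(1 - y)`. -/
lemma invSqrtPoly_bounds {N : ℕ} {y : ℝ} (hN : 0 < N) (h0 : 0 ≤ y) (h1 : y < 1) :
    0 ≤ 1 / √(1 - y) - invSqrtPoly N y ∧ 1 / √(1 - y) - invSqrtPoly N y ≤ y ^ N / (1 - y) := by
  obtain ⟨N, rfl⟩ := Nat.exists_eq_succ_of_ne_zero hN.ne'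
  rw [Nat.succ_eq_add_one]
  have hder : ∀ x ∈ Ico (0 : ℝ) 1, HasDerivAt (fun x => √(1 - x) * invSqrtPoly (N + 1) x)
      (-((N + 1) * invSqrtCoeff (N + 1) * x ^ N) / √(1 - x)) x := by
    intro x hx
    obtain ⟨d, hd, e⟩ := hasDerivAt_invSqrtPoly N x
    have hx1 : 0 < 1 - x := by linarith [hx.2]
    have hs := ((hasDerivAt_id x).const_sub 1).sqrt hx1.ne'
    refine (hs.mul hd).congr_deriv ?_
    have h2 := sqrt_pos.2 hx1
    have h3 := sq_sqrt hx1.le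
    simp only [id]
    field_simp
    rw [h3]
    linear_combination 2 * e
  have hder2 : ∀ x ∈ Ico (0 : ℝ) 1, HasDerivAt (fun x => x ^ (N + 1) / √(1 - x))
      ((N + 1) * x ^ N / √(1 - x) + x ^ (N + 1) / (2 * √(1 - x) ^ 3)) x := by
    intro x hx
    have hx1 : 0 < 1 - x := by linarith [hx.2]
    have hs := ((hasDerivAt_id x).const_sub 1).sqrt hx1.ne'
    have h2 := sqrt_pos.2 hx1
    refine ((hasDerivAt_pow (N + 1) x).div hs h2.ne').congr_deriv ?_
    simp only [id]
    push_cast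
    field_simp
    simp
  have hint : interior (Ico (0 : ℝ) 1) ⊆ Ico 0 1 := interior_subset
  have hanti : AntitoneOn (fun x => √(1 - x) * invSqrtPoly (N + 1) x) (Ico 0 1) := by
    refine antitoneOn_of_deriv_nonpos (convex_Ico 0 1)
      (fun x hx => (hder x hx).continuousAt.continuousWithinAt)
      (fun x hx => (hder x (hint hx)).differentiableAt.differentiableWithinAt) fun x hx => ?_
    rw [(hder x (hint hx)).deriv, neg_div]
    have := invSqrtCoeff_nonneg (N + 1)
    have := (hint hx).1
    exact neg_nonpos.2 (by positivity)
  have hmono : MonotoneOn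
      (fun x => √(1 - x) * invSqrtPoly (N + 1) x + x ^ (N + 1) / √(1 - x)) (Ico 0 1) := by
    refine monotoneOn_of_deriv_nonneg (convex_Ico 0 1)
      (fun x hx => ((hder x hx).add (hder2 x hx)).continuousAt.continuousWithinAt)
      (fun x hx => ((hder x (hint hx)).add (hder2 x (hint hx))).differentiableAt.differentiableWithinAt)
      fun x hx => ?_
    rw [((hder x (hint hx)).fun_add (hder2 x (hint hx))).deriv]
    have h2 := invSqrtCoeff_le_one (N + 1)
    have h3 := (hint hx).1
    have : -((N + 1) * invSqrtCoeff (N + 1) * x ^ N) / √(1 - x) + (N + 1) * x ^ N / √(1 - x)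
        = (1 - invSqrtCoeff (N + 1)) * ((N + 1) * x ^ N / √(1 - x)) := by ring
    rw [← add_assoc, this]
    have : 0 ≤ 1 - invSqrtCoeff (N + 1) := by linarith
    positivity
  have hz : invSqrtPoly (N + 1) 0 = 1 := by
    simp [invSqrtPoly, Finset.sum_range_succ', invSqrtCoeff_zero]
  have ha := hanti (left_mem_Ico.2 one_pos) ⟨h0, h1⟩ h0
  have hm := hmono (left_mem_Ico.2 one_pos) ⟨h0, h1⟩ h0
  simp only [sub_zero, sqrt_one, hz, one_mul, ne_eq, Nat.add_eq_zero_iff, one_ne_zero, and_false,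
    not_false_eq_true, zero_pow, zero_div, add_zero] at ha hm
  have hy : 0 < 1 - y := by linarith
  have hs := sqrt_pos.2 hy
  have hsq := sq_sqrt hy.le
  constructor
  · rw [sub_nonneg, le_div_iff₀ hs]
    linarith
  · rw [sub_le_iff_le_add, div_le_iff₀ hs]
    have : y ^ (N + 1) / (1 - y) = y ^ (N + 1) / √(1 - y) / √(1 - y) := by
      rw [div_div, ← sq, hsq]
    rw [this]
    refine hm.trans (le_of_eq ?_)
    field_simp
    ring

/-- The Taylor polynomial of `arcsin` with `N` terms. -/
noncomputable def arcsinPoly (N : ℕ) (t : ℝ) : ℝ :=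
  ∑ n ∈ Finset.range N, invSqrtCoeff n / (2 * n + 1) * t ^ (2 * n + 1)

lemma continuous_arcsinPoly (N : ℕ) : Continuous (arcsinPoly N) := by
  unfold arcsinPoly; fun_prop

lemma hasDerivAt_arcsinPoly (N : ℕ) (t : ℝ) :
    HasDerivAt (arcsinPoly N) (invSqrtPoly N (t ^ 2)) t := by
  unfold arcsinPoly invSqrtPoly
  refine HasDerivAt.fun_sum fun n _ => ?_
  refine ((hasDerivAt_pow (2 * n + 1) t).const_mul _).congr_deriv ?_
  push_cast
  rw [← pow_mul]
  field_simp

lemma arcsinPoly_bounds {N : ℕ} {t : ℝ} (hN : 0 < N) (h0 : 0 ≤ t) (h1 : t ≤ 1 / 2) :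
    0 ≤ arcsin t - arcsinPoly N t ∧ arcsin t - arcsinPoly N t ≤ 2 / 3 * (1 / 4) ^ N := by
  have hder : ∀ x ∈ Icc (0 : ℝ) t, HasDerivAt (fun x => arcsin x - arcsinPoly N x)
      (1 / √(1 - x ^ 2) - invSqrtPoly N (x ^ 2)) x := fun x hx =>
    (hasDerivAt_arcsin (by linarith [hx.1]) (by linarith [hx.2])).sub (hasDerivAt_arcsinPoly N x)
  have hb : ∀ x ∈ Icc (0 : ℝ) t, 0 ≤ 1 / √(1 - x ^ 2) - invSqrtPoly N (x ^ 2) ∧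
      1 / √(1 - x ^ 2) - invSqrtPoly N (x ^ 2) ≤ 4 / 3 * (1 / 4) ^ N := by
    intro x hx
    have hx2 : x ^ 2 ≤ 1 / 4 := by nlinarith [hx.1, hx.2]
    have := invSqrtPoly_bounds hN (sq_nonneg x) (by linarith)
    refine ⟨this.1, this.2.trans ?_⟩
    rw [div_le_iff₀ (by linarith)]
    have h4 : (x ^ 2) ^ N ≤ (1 / 4) ^ N := by gcongr
    have : (0 : ℝ) ≤ (1 / 4) ^ N := by positivity
    nlinarith
  have hcont : ContinuousOn (fun x => arcsin x - arcsinPoly N x) (Icc 0 t) :=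
    fun x hx => (hder x hx).continuousAt.continuousWithinAt
  have hint : interior (Icc (0 : ℝ) t) ⊆ Icc 0 t := interior_subset
  have hdiff : DifferentiableOn ℝ (fun x => arcsin x - arcsinPoly N x) (interior (Icc 0 t)) :=
    fun x hx => (hder x (hint hx)).differentiableAt.differentiableWithinAt
  have hz : arcsin 0 - arcsinPoly N 0 = 0 := by simp [arcsinPoly]
  have hl := (convex_Icc 0 t).mul_sub_le_image_sub_of_le_deriv hcont hdiff (C := 0)
    (fun x hx => by rw [(hder x (hint hx)).deriv]; exact (hb x (hint hx)).1)
    0 (left_mem_Icc.2 h0) t (right_mem_Icc.2 h0) h0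
  have hu := (convex_Icc 0 t).image_sub_le_mul_sub_of_deriv_le hcont hdiff
    (C := 4 / 3 * (1 / 4) ^ N)
    (fun x hx => by rw [(hder x (hint hx)).deriv]; exact (hb x (hint hx)).2)
    0 (left_mem_Icc.2 h0) t (right_mem_Icc.2 h0) h0
  simp only [hz, sub_zero, zero_mul] at hl hu
  refine ⟨hl, hu.trans ?_⟩
  have : (0 : ℝ) ≤ (1 / 4) ^ N := by positivity
  nlinarith

lemma integral_sin_pow_two_mul (n : ℕ) :
    ∫ x in (0 : ℝ)..(π / 2), sin x ^ (2 * n) = π / 2 * invSqrtCoeff n := by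
  induction n with
  | zero => simp [invSqrtCoeff_zero]
  | succ n ih =>
    rw [mul_add, mul_one, integral_sin_pow, ih, invSqrtCoeff_succ]
    simp
    ring

/-- The truncated power series of `2 / π * K(√3 / 2)`. -/
noncomputable def ellipticSum (N : ℕ) : ℝ :=
  ∑ n ∈ Finset.range N, invSqrtCoeff n ^ 2 * (3 / 4) ^ n

/-- Integrate the expansion at `y = 3/4 sin² x ≤ 3/4` termwise by Wallis; there `1 / (1 - y) ≤ 4`.
-/
lemma ellipticK_bounds {N : ℕ} (hN : 0 < N) :
    0 ≤ ellipticK (√3 / 2) - π / 2 * ellipticSum N ∧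
      ellipticK (√3 / 2) - π / 2 * ellipticSum N ≤ π / 2 * (4 * (3 / 4) ^ N) := by
  have e : π / 2 * ellipticSum N =
      ∫ x in (0 : ℝ)..(π / 2), invSqrtPoly N (3 / 4 * sin x ^ 2) := by
    unfold invSqrtPoly
    rw [intervalIntegral.integral_finsetSum]
    · rw [ellipticSum, Finset.mul_sum]
      refine Finset.sum_congr rfl fun n _ => ?_
      simp only [mul_pow, ← pow_mul, ← mul_assoc]
      rw [intervalIntegral.integral_const_mul, integral_sin_pow_two_mul]
      ring
    · intro n _
      exact Continuous.intervalIntegrable (by fun_prop) _ _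
  have hK : ellipticK (√3 / 2) = ∫ x in (0 : ℝ)..(π / 2), 1 / √(1 - 3 / 4 * sin x ^ 2) := by
    have : (√3 / 2) ^ 2 = 3 / 4 := by rw [div_pow, sq_sqrt_three]; norm_num
    simp only [ellipticK, this]
  have hb : ∀ x : ℝ, 0 ≤ 1 / √(1 - 3 / 4 * sin x ^ 2) - invSqrtPoly N (3 / 4 * sin x ^ 2) ∧
      1 / √(1 - 3 / 4 * sin x ^ 2) - invSqrtPoly N (3 / 4 * sin x ^ 2) ≤ 4 * (3 / 4) ^ N := by
    intro x
    have hs := sin_sq_le_one x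
    have hs0 := sq_nonneg (sin x)
    have := invSqrtPoly_bounds (y := 3 / 4 * sin x ^ 2) hN (by positivity) (by linarith)
    refine ⟨this.1, this.2.trans ?_⟩
    rw [div_le_iff₀ (by linarith)]
    have h4 : (3 / 4 * sin x ^ 2) ^ N ≤ (3 / 4) ^ N := by gcongr; linarith
    have : (0 : ℝ) ≤ (3 / 4) ^ N := by positivity
    nlinarith
  have hc1 : Continuous fun x => 1 / √(1 - 3 / 4 * sin x ^ 2) := by
    have : ∀ x, √(1 - 3 / 4 * sin x ^ 2) ≠ 0 := fun x => (delta_pos x).ne'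
    fun_prop (disch := assumption)
  have hc2 := continuous_invSqrtPoly N
  rw [hK, e, ← intervalIntegral.integral_sub (hc1.intervalIntegrable _ _)
    (Continuous.intervalIntegrable (by fun_prop) _ _)]
  constructor
  · exact intervalIntegral.integral_nonneg (by positivity) fun x _ => (hb x).1
  · calc _ ≤ ∫ x in (0 : ℝ)..(π / 2), 4 * (3 / 4 : ℝ) ^ N := by
          refine integral_mono (by positivity) ?_ (by simp) fun x => (hb x).2
          exact Continuous.intervalIntegrable (by fun_prop) _ _
      _ = _ := by simp; ring

/-! ### Moments of `cos x / (1 + cos x)` and the series for `oloidI`. -/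

/-- The argument of the arccosine in `oloidI`. -/
noncomputable def cosRatio (x : ℝ) : ℝ := cos x / (1 + cos x)

lemma cos_nonneg_of_mem_uIcc {x : ℝ} (hx : x ∈ uIcc 0 (π / 2)) : 0 ≤ cos x := by
  rw [uIcc_of_le (by positivity)] at hx
  exact cos_nonneg_of_neg_pi_div_two_le_of_le (by linarith [hx.1, pi_pos]) hx.2

lemma cosRatio_nonneg {x : ℝ} (hx : x ∈ uIcc 0 (π / 2)) : 0 ≤ cosRatio x := by
  have := cos_nonneg_of_mem_uIcc hx
  unfold cosRatio; positivity

lemma cosRatio_le_half {x : ℝ} (hx : x ∈ uIcc 0 (π / 2)) : cosRatio x ≤ 1 / 2 := by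
  have := cos_nonneg_of_mem_uIcc hx
  rw [cosRatio, div_le_iff₀ (by positivity)]
  linarith [cos_le_one x]

lemma continuousOn_cosRatio : ContinuousOn cosRatio (uIcc 0 (π / 2)) := by
  refine ContinuousOn.div (by fun_prop) (by fun_prop) fun x hx => ?_
  have := cos_nonneg_of_mem_uIcc hx
  positivity

lemma continuousOn_inv_one_add_cos : ContinuousOn (fun x => 1 / (1 + cos x)) (uIcc 0 (π / 2)) := by
  refine ContinuousOn.div (by fun_prop) (by fun_prop) fun x hx => ?_
  have := cos_nonneg_of_mem_uIcc hx
  positivity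

/-- The moments `∫ (cos x / (1 + cos x)) ^ m`. -/
noncomputable def moment (m : ℕ) : ℝ := ∫ x in (0 : ℝ)..(π / 2), cosRatio x ^ m

/-- The moments of `cos x / (1 + cos x)` with weight `1 / (1 + cos x)`. -/
noncomputable def weightedMoment (m : ℕ) : ℝ :=
  ∫ x in (0 : ℝ)..(π / 2), cosRatio x ^ m * (1 / (1 + cos x))

lemma intervalIntegrable_moment (m : ℕ) :
    IntervalIntegrable (fun x => cosRatio x ^ m) volume 0 (π / 2) :=
  (continuousOn_cosRatio.pow m).intervalIntegrable

lemma intervalIntegrable_weightedMoment (m : ℕ) :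
    IntervalIntegrable (fun x => cosRatio x ^ m * (1 / (1 + cos x))) volume 0 (π / 2) :=
  ((continuousOn_cosRatio.pow m).mul continuousOn_inv_one_add_cos).intervalIntegrable

lemma moment_zero : moment 0 = π / 2 := by simp [moment]

/-- Because `1 - cosRatio x = 1 / (1 + cos x)`. -/
lemma moment_eq_add (m : ℕ) : moment m = weightedMoment m + moment (m + 1) := by
  unfold moment weightedMoment
  rw [← integral_add (intervalIntegrable_weightedMoment m) (intervalIntegrable_moment (m + 1))]
  refine integral_congr fun x hx => ?_
  have := cos_nonneg_of_mem_uIcc hx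
  simp only [cosRatio]
  rw [pow_succ]
  field_simp

lemma hasDerivAt_tan_half {x : ℝ} (hx : 0 ≤ cos x) :
    HasDerivAt (fun x => sin x / (1 + cos x)) (1 / (1 + cos x)) x := by
  have h := (hasDerivAt_sin x).div ((hasDerivAt_cos x).const_add 1) (by positivity)
  refine h.congr_deriv ?_
  have := sin_sq_add_cos_sq x
  field_simp
  linear_combination this

lemma hasDerivAt_cosRatio {x : ℝ} (hx : 0 ≤ cos x) :
    HasDerivAt cosRatio (-sin x / (1 + cos x) ^ 2) x := by
  have h := (hasDerivAt_cos x).div ((hasDerivAt_cos x).const_add 1) (by positivity)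
  refine h.congr_deriv ?_
  field_simp
  ring

lemma weightedMoment_zero : weightedMoment 0 = 1 := by
  have := integral_eq_sub_of_hasDerivAt (a := 0) (b := π / 2)
    (fun x hx => hasDerivAt_tan_half (cos_nonneg_of_mem_uIcc hx))
    continuousOn_inv_one_add_cos.intervalIntegrable
  simpa [weightedMoment] using this

/-- Integrate the derivative of `tan (x / 2) * cosRatio x ^ (m + 1)`, which vanishes at `0` and at
`π / 2`. -/
lemma weightedMoment_succ (m : ℕ) :
    weightedMoment (m + 1) = (m + 1) / (2 * m + 3) * weightedMoment m := by
  have hder : ∀ x ∈ uIcc 0 (π / 2), HasDerivAt (fun x => sin x / (1 + cos x) * cosRatio x ^ (m + 1))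
      ((2 * m + 3) * (cosRatio x ^ (m + 1) * (1 / (1 + cos x)))
        - (m + 1) * (cosRatio x ^ m * (1 / (1 + cos x)))) x := by
    intro x hx
    have hc := cos_nonneg_of_mem_uIcc hx
    refine ((hasDerivAt_tan_half hc).mul ((hasDerivAt_cosRatio hc).pow (m + 1))).congr_deriv ?_
    have := sin_sq_add_cos_sq x
    simp only [Pi.pow_apply, cosRatio]
    push_cast
    rw [pow_succ]
    generalize (cos x / (1 + cos x)) ^ m = T
    field_simp
    linear_combination (-(m + 1) * T) * this
  have h := integral_eq_sub_of_hasDerivAt hder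
    (((intervalIntegrable_weightedMoment (m + 1)).const_mul _).sub
      ((intervalIntegrable_weightedMoment m).const_mul _))
  rw [intervalIntegral.integral_sub ((intervalIntegrable_weightedMoment (m + 1)).const_mul _)
      ((intervalIntegrable_weightedMoment m).const_mul _), intervalIntegral.integral_const_mul,
    intervalIntegral.integral_const_mul] at h
  simp [cosRatio] at h
  have h' : (2 * m + 3) * weightedMoment (m + 1) - (m + 1) * weightedMoment m = 0 := by
    simpa [weightedMoment, cosRatio] using h
  field_simp
  linear_combination h'

lemma weightedMoment_pos (m : ℕ) : 0 < weightedMoment m := by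
  induction m with
  | zero => simp [weightedMoment_zero]
  | succ m ih => rw [weightedMoment_succ]; positivity

lemma moment_nonneg (m : ℕ) : 0 ≤ moment m :=
  intervalIntegral.integral_nonneg (by positivity) fun x hx =>
    pow_nonneg (cosRatio_nonneg (by rwa [uIcc_of_le (by positivity)])) m

lemma moment_le (m : ℕ) : moment m ≤ 2 * weightedMoment m := by
  unfold moment weightedMoment
  rw [← intervalIntegral.integral_const_mul]
  refine integral_mono_on (by positivity) (intervalIntegrable_moment m)
    ((intervalIntegrable_weightedMoment m).const_mul 2) fun x hx => ?_
  rw [← uIcc_of_le (by positivity)] at hx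
  have hc := cos_nonneg_of_mem_uIcc hx
  have ht := pow_nonneg (cosRatio_nonneg hx) m
  have : 1 ≤ 2 * (1 / (1 + cos x)) := by
    rw [mul_one_div, le_div_iff₀ (by positivity)]
    linarith [cos_le_one x]
  nlinarith

/-- The quotient of the two moments, which is computed by backward recursion. -/
noncomputable def momentRatio (m : ℕ) : ℝ := moment m / weightedMoment m

lemma momentRatio_nonneg (m : ℕ) : 0 ≤ momentRatio m :=
  div_nonneg (moment_nonneg m) (weightedMoment_pos m).le

lemma momentRatio_le_two (m : ℕ) : momentRatio m ≤ 2 :=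
  (div_le_iff₀ (weightedMoment_pos m)).2 (moment_le m)

/-- Run backwards, this recursion contracts errors by at least `1/2` per step, so the crude bound
`momentRatio ≤ 2` far out suffices as a start. -/
lemma momentRatio_eq (m : ℕ) :
    momentRatio m = 1 + ((m + 1 : ℕ) : ℝ) / ((2 * m + 3 : ℕ) : ℝ) * momentRatio (m + 1) := by
  have h0 := weightedMoment_pos m
  unfold momentRatio
  rw [moment_eq_add m, weightedMoment_succ]
  push_cast
  field_simp

lemma momentRatio_zero : momentRatio 0 = π / 2 := by
  rw [momentRatio, moment_zero, weightedMoment_zero, div_one]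

/-- The truncated series of `∫ arcsin (cos x / (1 + cos x))`. -/
noncomputable def arcsinSum (N : ℕ) : ℝ :=
  ∑ n ∈ Finset.range N, invSqrtCoeff n / (2 * n + 1) * moment (2 * n + 1)

lemma oloidI_bounds {N : ℕ} (hN : 0 < N) :
    0 ≤ π ^ 2 / 4 - oloidI - arcsinSum N ∧
      π ^ 2 / 4 - oloidI - arcsinSum N ≤ π / 2 * (2 / 3 * (1 / 4) ^ N) := by
  have e : arcsinSum N = ∫ x in (0 : ℝ)..(π / 2), arcsinPoly N (cosRatio x) := by
    unfold arcsinPoly arcsinSum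
    rw [intervalIntegral.integral_finsetSum]
    · simp only [intervalIntegral.integral_const_mul, moment]
    · intro n _
      exact (intervalIntegrable_moment _).const_mul _
  have hI1 : IntervalIntegrable (fun x => arcsin (cosRatio x)) volume 0 (π / 2) :=
    (continuous_arcsin.comp_continuousOn continuousOn_cosRatio).intervalIntegrable
  have hI2 : IntervalIntegrable (fun x => arcsinPoly N (cosRatio x)) volume 0 (π / 2) :=
    ((continuous_arcsinPoly N).comp_continuousOn continuousOn_cosRatio).intervalIntegrable
  have hI : oloidI = π ^ 2 / 4 - ∫ x in (0 : ℝ)..(π / 2), arcsin (cosRatio x) := by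
    unfold oloidI
    simp only [arccos_eq_pi_div_two_sub_arcsin]
    refine (intervalIntegral.integral_sub (by simp) hI1).trans ?_
    simp
    ring
  rw [hI, e, sub_sub_cancel, ← intervalIntegral.integral_sub hI1 hI2]
  have hb : ∀ x ∈ Icc 0 (π / 2), _ := fun x hx =>
    have hx' : x ∈ uIcc 0 (π / 2) := by rwa [uIcc_of_le (by positivity)]
    arcsinPoly_bounds hN (cosRatio_nonneg hx') (cosRatio_le_half hx')
  constructor
  · exact intervalIntegral.integral_nonneg (by positivity) fun x hx => (hb x hx).1
  · calc _ ≤ ∫ x in (0 : ℝ)..(π / 2), 2 / 3 * (1 / 4 : ℝ) ^ N :=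
          integral_mono_on (by positivity) (hI1.sub hI2) (by simp) fun x hx => (hb x hx).2
      _ = _ := by simp; ring

/-! ### Certified fixed-point evaluation. -/

/-- Horner evaluation `C i + num i / den i * (C (i + 1) + ...)` with `k` terms, rounding down. -/
def natHorner (C num den : ℕ → ℕ) : ℕ → ℕ → ℕ
  | 0, _ => 0
  | k + 1, i => C i + num i * natHorner C num den k (i + 1) / den i

/-- A step adds at most `d` from the coefficient and `1` from the floor, and multiplies the earlier
error by at most `r`: a geometric series plus the contracted starting value, bounded by `B`. -/
lemma natHorner_bounds {C num den : ℕ → ℕ} {S r d B : ℝ} {c : ℕ → ℝ} {X : ℕ → ℕ → ℝ}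
    (hS : 0 ≤ S) (hr : r < 1) (hden : ∀ i, 0 < den i)
    (hratio : ∀ i, (num i : ℝ) ≤ r * den i)
    (hX : ∀ k i, X (k + 1) i = c i + (num i : ℝ) / den i * X k (i + 1))
    (h0 : ∀ i, 0 ≤ X 0 i) (hB : ∀ i, X 0 i ≤ B)
    (hC : ∀ i, (C i : ℝ) ≤ S * c i) (hd : ∀ i, S * c i ≤ C i + d) (hd0 : 0 ≤ d) (k i : ℕ) :
    (natHorner C num den k i : ℝ) ≤ S * X k i ∧
      S * X k i ≤ natHorner C num den k i + ((d + 1) / (1 - r) + S * B * r ^ k) := by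
  have hr1 : 0 < 1 - r := by linarith
  have hr0 : 0 ≤ r := by
    have h1 : (0 : ℝ) < den 0 := by exact_mod_cast hden 0
    have h2 : (0 : ℝ) ≤ num 0 := by positivity
    by_contra h
    nlinarith [hratio 0]
  induction k generalizing i with
  | zero =>
    have h1 := mul_nonneg hS (h0 i)
    have h2 := mul_le_mul_of_nonneg_left (hB i) hS
    have : 0 ≤ (d + 1) / (1 - r) := by positivity
    simp only [natHorner, Nat.cast_zero, pow_zero, mul_one, zero_add]
    exact ⟨h1, by linarith⟩
  | succ k ih =>
    obtain ⟨l, u⟩ := ih (i + 1)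
    have hdi : (0 : ℝ) < den i := by exact_mod_cast hden i
    have hq0 : (0 : ℝ) ≤ (num i : ℝ) / den i := by positivity
    have hqr : (num i : ℝ) / den i ≤ r := (div_le_iff₀ hdi).2 (hratio i)
    rw [hX, natHorner]
    set F := natHorner C num den k (i + 1)
    have e : ((num i * F : ℕ) : ℝ) / den i = (num i : ℝ) / den i * F := by push_cast; ring
    have hf1 : ((num i * F / den i : ℕ) : ℝ) ≤ (num i : ℝ) / den i * F := e ▸ Nat.cast_div_le
    have hf2 : (num i : ℝ) / den i * F ≤ ((num i * F / den i : ℕ) : ℝ) + 1 := by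
      rw [← e, ← Nat.floor_div_eq_div (K := ℝ)]
      exact (Nat.lt_floor_add_one _).le
    have hE : 0 ≤ (d + 1) / (1 - r) + S * B * r ^ k := by linarith
    have hm1 := mul_le_mul_of_nonneg_left l hq0
    have hm2 := mul_le_mul_of_nonneg_left u hq0
    have hm3 := mul_le_mul_of_nonneg_right hqr hE
    have he : (d + 1) / (1 - r) = d + 1 + r * ((d + 1) / (1 - r)) := by field_simp; ring
    have e1 : S * (c i + (num i : ℝ) / den i * X k (i + 1)) =
        S * c i + (num i : ℝ) / den i * (S * X k (i + 1)) := by ring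
    rw [e1, pow_succ]
    push_cast
    constructor
    · linarith [hC i]
    · nlinarith [hd i]

/-- If `g (i + 1) = ratio i * g i`, then the sums `∑ g (i + j) * c (i + j)` satisfy the Horner
recursion after division by `g i`. -/
lemma sum_range_succ_div {g c ratio : ℕ → ℝ} (hg : ∀ i, g i ≠ 0)
    (h : ∀ i, g (i + 1) = ratio i * g i) (k i : ℕ) :
    (∑ j ∈ Finset.range (k + 1), g (i + j) * c (i + j)) / g i =
      c i + ratio i * ((∑ j ∈ Finset.range k, g (i + 1 + j) * c (i + 1 + j)) / g (i + 1)) := by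
  have h1 := hg i
  have h2 := hg (i + 1)
  have h3 : ratio i ≠ 0 := by
    intro h0
    rw [h, h0, zero_mul] at h2
    exact h2 rfl
  rw [Finset.sum_range_succ', add_zero, h i]
  simp only [add_comm, add_left_comm]
  field_simp

/-- Fixed-point value of `momentRatio m` at scale `10 ^ 36`. -/
def momentRatioNat (m : ℕ) : ℕ :=
  natHorner (fun _ => 10 ^ 36) (fun m => m + 1) (fun m => 2 * m + 3) 130 m

/-- The error `3` is `1 / (1 - 1/2) = 2` from rounding, plus less than `1` from starting at `0`
after 130 halvings. `X` ignores `k` since the recursion is exact. -/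
lemma momentRatioNat_bounds (m : ℕ) :
    (momentRatioNat m : ℝ) ≤ 10 ^ 36 * momentRatio m ∧
      10 ^ 36 * momentRatio m ≤ momentRatioNat m + 3 := by
  have h := natHorner_bounds (C := fun _ => 10 ^ 36) (num := fun m => m + 1)
    (den := fun m => 2 * m + 3) (S := 10 ^ 36) (r := 1 / 2) (d := 0) (B := 2) (c := fun _ => 1)
    (X := fun _ m => momentRatio m) (by norm_num) (by norm_num) (by simp)
    (fun m => by push_cast; linarith) (fun _ m => momentRatio_eq m)
    (fun _ => momentRatio_nonneg _) (fun _ => momentRatio_le_two _) (fun _ => by norm_num)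
    (fun _ => by norm_num) le_rfl 130 m
  exact ⟨h.1, h.2.trans (add_le_add_right (by norm_num) _)⟩

lemma pi_bounds :
    (2 * 1570796326794896619231321691639751442 / 10 ^ 36 : ℝ) ≤ π ∧ π ≤ 2 * (1570796326794896619231321691639751442 + 3) / 10 ^ 36 := by
  have h := momentRatioNat_bounds 0
  have e : momentRatioNat 0 = 1570796326794896619231321691639751442 := by decide +kernel
  rw [e, momentRatio_zero] at h
  push_cast at h
  constructor
  · linarith [h.1]
  · linarith [h.2]

lemma ellipticSum_bounds :
    (1372880500618350164697637575007805764 / 10 ^ 36 : ℝ) ≤ ellipticSum 250 ∧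
      ellipticSum 250 ≤ (1372880500618350164697637575007805764 + 4) / 10 ^ 36 := by
  have hb : ∀ n, 0 < invSqrtCoeff n := fun n => by
    unfold invSqrtCoeff
    have := Nat.centralBinom_pos n
    positivity
  have hrec := sum_range_succ_div (g := fun n => invSqrtCoeff n ^ 2 * (3 / 4) ^ n)
    (c := fun _ => 1)
    (ratio := fun n => ((3 * (2 * n + 1) ^ 2 : ℕ) : ℝ) / ((4 * n + 4) ^ 2 : ℕ))
    (fun n => by have := hb n; positivity)
    (fun n => by
      simp only [invSqrtCoeff_succ]
      push_cast
      field_simp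
      ring)
  have h := natHorner_bounds (C := fun _ => 10 ^ 36) (S := 10 ^ 36) (r := 3 / 4) (d := 0) (B := 0)
    (c := fun _ => 1) (X := fun k i => (∑ j ∈ Finset.range k,
      invSqrtCoeff (i + j) ^ 2 * (3 / 4) ^ (i + j) * 1) / (invSqrtCoeff i ^ 2 * (3 / 4) ^ i))
    (num := fun n => 3 * (2 * n + 1) ^ 2) (den := fun n => (4 * n + 4) ^ 2)
    (by norm_num) (by norm_num) (fun n => by positivity)
    (fun n => by push_cast; nlinarith [(Nat.cast_nonneg n : (0 : ℝ) ≤ n)])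
    hrec (by simp) (by simp) (fun _ => by norm_num) (fun _ => by norm_num) le_rfl 250 0
  have e : natHorner (fun _ => 10 ^ 36) (fun n => 3 * (2 * n + 1) ^ 2) (fun n => (4 * n + 4) ^ 2)
      250 0 = 1372880500618350164697637575007805764 := by decide +kernel
  rw [e] at h
  have e2 : (∑ j ∈ Finset.range 250, invSqrtCoeff (0 + j) ^ 2 * (3 / 4) ^ (0 + j) * 1) /
      (invSqrtCoeff 0 ^ 2 * (3 / 4) ^ 0) = ellipticSum 250 := by
    simp [ellipticSum, invSqrtCoeff_zero]
  rw [e2] at h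
  push_cast at h
  constructor
  · linarith [h.1]
  · linarith [h.2]

/-- The leading factor `weightedMoment 1 = 1/3` is divided out by the Horner form, hence the scale
`3 * 10 ^ 36`. The error is `(3 + 1) / (1 - 1/4) = 16/3 ≤ 6`, with the `3` inherited from
`momentRatioNat`. -/
lemma arcsinSum_bounds :
    (1770060137969595478950807100192685421 / (3 * 10 ^ 36) : ℝ) ≤ arcsinSum 55 ∧
      arcsinSum 55 ≤ (1770060137969595478950807100192685421 + 6) / (3 * 10 ^ 36) := by
  have hb : ∀ n, 0 < invSqrtCoeff n := fun n => by
    unfold invSqrtCoeff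
    have := Nat.centralBinom_pos n
    positivity
  have hrec := sum_range_succ_div
    (g := fun n => invSqrtCoeff n / (2 * n + 1) * weightedMoment (2 * n + 1))
    (c := fun n => momentRatio (2 * n + 1))
    (ratio := fun n => (((2 * n + 1) ^ 2 : ℕ) : ℝ) / ((4 * n + 5) * (4 * n + 7) : ℕ))
    (fun n => by have := hb n; have := weightedMoment_pos (2 * n + 1); positivity)
    (fun n => by
      simp only [invSqrtCoeff_succ]
      rw [show 2 * (n + 1) + 1 = 2 * n + 1 + 1 + 1 by ring, weightedMoment_succ,
        weightedMoment_succ]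
      push_cast
      field_simp
      ring)
  have h := natHorner_bounds (C := fun n => momentRatioNat (2 * n + 1)) (S := 10 ^ 36)
    (r := 1 / 4) (d := 3) (B := 0) (c := fun n => momentRatio (2 * n + 1))
    (X := fun k i => (∑ j ∈ Finset.range k, invSqrtCoeff (i + j) / (2 * (i + j : ℕ) + 1) *
      weightedMoment (2 * (i + j) + 1) * momentRatio (2 * (i + j) + 1)) /
        (invSqrtCoeff i / (2 * i + 1) * weightedMoment (2 * i + 1)))
    (num := fun n => (2 * n + 1) ^ 2) (den := fun n => (4 * n + 5) * (4 * n + 7))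
    (by norm_num) (by norm_num) (fun n => by positivity)
    (fun n => by push_cast; nlinarith [(Nat.cast_nonneg n : (0 : ℝ) ≤ n)])
    hrec (by simp) (by simp) (fun n => (momentRatioNat_bounds _).1)
    (fun n => (momentRatioNat_bounds _).2) (by norm_num) 55 0
  have e : natHorner (fun n => momentRatioNat (2 * n + 1)) (fun n => (2 * n + 1) ^ 2)
      (fun n => (4 * n + 5) * (4 * n + 7)) 55 0 = 1770060137969595478950807100192685421 := by
    decide +kernel
  have e2 : (∑ j ∈ Finset.range 55, invSqrtCoeff (0 + j) / (2 * (0 + j : ℕ) + 1) *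
      weightedMoment (2 * (0 + j) + 1) * momentRatio (2 * (0 + j) + 1)) /
      (invSqrtCoeff 0 / (2 * (0 : ℕ) + 1) * weightedMoment (2 * 0 + 1)) = 3 * arcsinSum 55 := by
    have h1 : weightedMoment (2 * 0 + 1) = 1 / 3 := by
      rw [mul_zero, weightedMoment_succ, weightedMoment_zero]; norm_num
    rw [h1, invSqrtCoeff_zero, arcsinSum, Finset.mul_sum, Finset.sum_div]
    refine Finset.sum_congr rfl fun j _ => ?_
    have := (weightedMoment_pos (2 * j + 1)).ne'
    rw [momentRatio, zero_add]
    field_simp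
    norm_num
  rw [e, e2] at h
  push_cast at h
  constructor
  · linarith [h.1]
  · linarith [h.2]

lemma oloid_coefficient_bounds :
    |3 / (2 * π) * ellipticK (√3 / 2) + 3 * π / 4 - 2 / π * oloidI
      - 2.19067696623158876633263049436| ≤ 1 / 2 * (1 / 10 ^ 29) := by
  obtain ⟨p1, p2⟩ := pi_bounds
  obtain ⟨e1, e2⟩ := ellipticSum_bounds
  obtain ⟨a1, a2⟩ := arcsinSum_bounds
  obtain ⟨k1, k2⟩ := ellipticK_bounds (N := 250) (by norm_num)
  obtain ⟨i1, i2⟩ := oloidI_bounds (N := 55) (by norm_num)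
  have hpi := pi_pos
  have hK : 3 / (2 * π) * ellipticK (√3 / 2) =
      3 / 4 * ellipticSum 250 +
        3 / (2 * π) * (ellipticK (√3 / 2) - π / 2 * ellipticSum 250) := by
    field_simp; ring
  have hI : 3 * π / 4 - 2 / π * oloidI =
      π / 4 + 2 * arcsinSum 55 / π + 2 / π * (π ^ 2 / 4 - oloidI - arcsinSum 55) := by
    field_simp; ring
  have hK1 : 0 ≤ 3 / (2 * π) * (ellipticK (√3 / 2) - π / 2 * ellipticSum 250) := by positivity
  have hK2 : 3 / (2 * π) * (ellipticK (√3 / 2) - π / 2 * ellipticSum 250) ≤ 3 * (3 / 4) ^ 250 := by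
    refine (mul_le_mul_of_nonneg_left k2 (by positivity)).trans (le_of_eq ?_)
    field_simp; norm_num
  have hI1 : 0 ≤ 2 / π * (π ^ 2 / 4 - oloidI - arcsinSum 55) := by positivity
  have hI2 : 2 / π * (π ^ 2 / 4 - oloidI - arcsinSum 55) ≤ 2 / 3 * (1 / 4) ^ 55 := by
    refine (mul_le_mul_of_nonneg_left i2 (by positivity)).trans (le_of_eq ?_)
    field_simp
  have hA1 : (2 * (1770060137969595478950807100192685421 / (3 * 10 ^ 36)) /
      (2 * (1570796326794896619231321691639751442 + 3) / 10 ^ 36) : ℝ) ≤ 2 * arcsinSum 55 / π := by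
    gcongr
  have hA2 : 2 * arcsinSum 55 / π ≤ (2 * ((1770060137969595478950807100192685421 + 6) / (3 * 10 ^ 36)) /
      (2 * 1570796326794896619231321691639751442 / 10 ^ 36) : ℝ) := by
    gcongr
  rw [add_sub_assoc, hK, hI, abs_le]
  constructor
  · norm_num at *
    linarith
  · norm_num at *
    linarith

/-! ### Gaussian integrals on the sphere and in cylindrical coordinates. -/

lemma lintegral_Ioi_pow_three_mul_exp {c : ℝ} (hc : 0 < c) :
    ∫⁻ ρ in Ioi (0 : ℝ), ENNReal.ofReal (ρ ^ 3 * exp (-(c * ρ ^ 2))) =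
      ENNReal.ofReal (1 / (2 * c ^ 2)) := by
  have h := integral_rpow_mul_exp_neg_mul_rpow (p := 2) (q := 3) (b := c) (by norm_num)
    (by norm_num) hc
  have hi := integrableOn_rpow_mul_exp_neg_mul_rpow (p := 2) (s := 3) (b := c) (by norm_num)
    (by norm_num) hc
  have e : ∀ ρ ∈ Ioi (0 : ℝ), ρ ^ (3 : ℝ) * exp (-c * ρ ^ (2 : ℝ)) =
      ρ ^ 3 * exp (-(c * ρ ^ 2)) := by
    intro ρ hρ
    norm_cast
    rw [neg_mul]
  rw [setIntegral_congr_fun measurableSet_Ioi e] at h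
  rw [integrableOn_congr_fun e measurableSet_Ioi] at hi
  rw [← ofReal_integral_eq_lintegral_ofReal hi, h]
  · congr 1
    have : Gamma ((3 + 1) / 2) = 1 := by norm_num
    rw [this]
    norm_num
  · filter_upwards [ae_restrict_mem measurableSet_Ioi] with ρ hρ
    have : (0 : ℝ) < ρ := hρ
    positivity

/-- Radial integration of a positively homogeneous function against a Gaussian weight. -/
lemma lintegral_gaussian_eq_lintegral_sphere {f : E3 → ℝ} (hf : Measurable f)
    (hom : ∀ t : ℝ, 0 < t → ∀ w, f (t • w) = t * f w) :
    ∫⁻ w : E3, ENNReal.ofReal (f w * exp (-‖w‖ ^ 2)) =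
      ENNReal.ofReal (1 / 2) * ∫⁻ w : Metric.sphere (0 : E3) 1, ENNReal.ofReal (f w)
        ∂(volume : Measure E3).toSphere := by
  set F : E3 → ENNReal := fun w => ENNReal.ofReal (f w * exp (-‖w‖ ^ 2)) with hF
  have hFm : Measurable F := by fun_prop
  calc ∫⁻ w, F w = ∫⁻ w : ({(0 : E3)}ᶜ : Set E3), F w ∂((volume : Measure E3).comap (↑)) := by
        rw [lintegral_subtype_comap (measurableSet_singleton _).compl F, restrict_compl_singleton]
    _ = ∫⁻ p, F (p.2.1 • p.1.1) ∂(volume : Measure E3).toSphere.prod (.volumeIoiPow 2) := by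
        have h := (volume : Measure E3).measurePreserving_homeomorphUnitSphereProd
        have hd : Module.finrank ℝ E3 - 1 = 2 := by simp
        rw [hd] at h
        rw [← h.lintegral_comp_emb (Homeomorph.measurableEmbedding _)]
        refine lintegral_congr fun w => ?_
        congr 1
        have hw : ‖(w : E3)‖ ≠ 0 := norm_ne_zero_iff.2 w.2
        simp [smul_smul, hw]
    _ = ∫⁻ w : Metric.sphere (0 : E3) 1, ENNReal.ofReal (1 / 2) * ENNReal.ofReal (f w)
        ∂(volume : Measure E3).toSphere := by
        rw [lintegral_prod _ (by fun_prop)]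
        refine lintegral_congr fun w => ?_
        have hw : ‖(w : E3)‖ = 1 := by simp
        rw [Measure.volumeIoiPow, lintegral_withDensity_eq_lintegral_mul _ (by fun_prop)
          (by fun_prop)]
        have h1 := lintegral_subtype_comap (μ := volume) (measurableSet_Ioi (a := (0 : ℝ)))
          (fun ρ => ENNReal.ofReal (ρ ^ 2) * F (ρ • w.1))
        simp only [Pi.mul_apply]
        refine h1.trans ?_
        have h2 : ∀ ρ ∈ Ioi (0 : ℝ), ENNReal.ofReal (ρ ^ 2) * F (ρ • w.1) =
            ENNReal.ofReal (ρ ^ 3 * exp (-(1 * ρ ^ 2))) * ENNReal.ofReal (f w) := by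
          intro ρ hρ
          have h0 : (0 : ℝ) < ρ := hρ
          rw [hF]
          simp only [hom ρ h0]
          rw [← ENNReal.ofReal_mul (by positivity), ← ENNReal.ofReal_mul (by positivity),
            norm_smul, hw, norm_eq_abs, abs_of_pos h0]
          congr 1
          ring_nf
        rw [setLIntegral_congr_fun measurableSet_Ioi h2, lintegral_mul_const _ (by fun_prop),
          lintegral_Ioi_pow_three_mul_exp one_pos]
        norm_num
    _ = _ := lintegral_const_mul _ (by fun_prop)

lemma lintegral_eq_mul_lintegral_comp_mul {ρ : ℝ} (hρ : 0 < ρ) (h : ℝ → ENNReal) :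
    ∫⁻ z, h z = ENNReal.ofReal ρ * ∫⁻ t, h (ρ * t) := by
  conv_lhs => rw [← Real.smul_map_volume_mul_left hρ.ne', abs_of_pos hρ]
  rw [lintegral_smul_measure, smul_eq_mul]
  congr 1
  exact (Homeomorph.mulLeft₀ ρ hρ.ne').toMeasurableEquiv.measurableEmbedding.lintegral_map h

/-- Gaussian integrals of positively homogeneous functions in cylindrical coordinates
`(z, (x, y)) = ρ • (t, (cos φ, sin φ))`, after integration over `ρ`. -/
lemma lintegral_gaussian_eq_lintegral_cylinder {f : ℝ × ℝ × ℝ → ℝ} (hf : Measurable f)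
    (hom : ∀ t : ℝ, 0 < t → ∀ p, f (t • p) = t * f p) :
    ∫⁻ p : ℝ × ℝ × ℝ, ENNReal.ofReal (f p * exp (-(p.1 ^ 2 + p.2.1 ^ 2 + p.2.2 ^ 2))) =
      ∫⁻ φ in Ioo (-π) π, ∫⁻ t : ℝ,
        ENNReal.ofReal (1 / (2 * (1 + t ^ 2) ^ 2)) * ENNReal.ofReal (f (t, cos φ, sin φ)) := by
  rw [Measure.volume_eq_prod, lintegral_prod_symm _ (by fun_prop),
    ← lintegral_comp_polarCoord_symm]
  have h1 : ∀ q ∈ polarCoord.target, ENNReal.ofReal q.1 • ∫⁻ z : ℝ,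
      ENNReal.ofReal (f (z, polarCoord.symm q) *
        exp (-(z ^ 2 + (polarCoord.symm q).1 ^ 2 + (polarCoord.symm q).2 ^ 2))) =
      ∫⁻ t : ℝ, ENNReal.ofReal (q.1 ^ 3 * exp (-((1 + t ^ 2) * q.1 ^ 2))) *
        ENNReal.ofReal (f (t, cos q.2, sin q.2)) := by
    rintro ⟨ρ, φ⟩ hq
    have h0 : 0 < ρ := hq.1
    rw [lintegral_eq_mul_lintegral_comp_mul h0, smul_eq_mul, ← mul_assoc,
      ← ENNReal.ofReal_mul h0.le, ← lintegral_const_mul _ (by fun_prop)]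
    refine lintegral_congr fun t => ?_
    have e : ((ρ * t, polarCoord.symm (ρ, φ)) : ℝ × ℝ × ℝ) = ρ • (t, cos φ, sin φ) := by
      simp [polarCoord]
    rw [e, hom ρ h0, ← ENNReal.ofReal_mul (by positivity), ← ENNReal.ofReal_mul (by positivity)]
    have e2 : (ρ * t) ^ 2 + (polarCoord.symm (ρ, φ)).1 ^ 2 + (polarCoord.symm (ρ, φ)).2 ^ 2
        = (1 + t ^ 2) * ρ ^ 2 := by
      simp [polarCoord]
      linear_combination ρ ^ 2 * sin_sq_add_cos_sq φ
    rw [e2]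
    congr 1
    ring
  rw [setLIntegral_congr_fun polarCoord.open_target.measurableSet h1, polarCoord_target,
    Measure.volume_eq_prod, ← Measure.prod_restrict, lintegral_prod_symm _ (by fun_prop)]
  refine lintegral_congr fun φ => ?_
  rw [lintegral_lintegral_swap (by fun_prop)]
  refine lintegral_congr fun t => ?_
  simp only
  rw [lintegral_mul_const _ (by fun_prop), lintegral_Ioi_pow_three_mul_exp (by positivity)]

lemma integral_one_div_one_add_sq_sq {s : ℝ} :
    ∫ t in (-s)..s, 1 / (2 * (1 + t ^ 2) ^ 2) = capIntegral s / 2 := by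
  have hd : ∀ t ∈ uIcc (-s) s, HasDerivAt (fun t => capIntegral t / 4) (1 / (2 * (1 + t ^ 2) ^ 2)) t := by
    intro t _
    have h1 : HasDerivAt (fun t : ℝ => 1 + t ^ 2) (2 * t) t := by
      simpa using (hasDerivAt_pow 2 t).const_add 1
    have h := ((hasDerivAt_arctan t).add ((hasDerivAt_id t).div h1 (by positivity))).div_const 4
    refine h.congr_deriv ?_
    simp only [id]
    field_simp
    ring
  rw [integral_eq_sub_of_hasDerivAt hd (Continuous.intervalIntegrable
    (by have : ∀ t : ℝ, 2 * (1 + t ^ 2) ^ 2 ≠ 0 := fun t => by positivity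
        fun_prop (disch := assumption)) _ _)]
  simp [capIntegral, arctan_neg]
  ring

lemma lintegral_Icc_one_div_one_add_sq_sq {s : ℝ} (hs : 0 ≤ s) :
    ∫⁻ t in Icc (-s) s, ENNReal.ofReal (1 / (2 * (1 + t ^ 2) ^ 2)) =
      ENNReal.ofReal (capIntegral s / 2) := by
  have hc : Continuous fun t : ℝ => 1 / (2 * (1 + t ^ 2) ^ 2) := by
    have : ∀ t : ℝ, 2 * (1 + t ^ 2) ^ 2 ≠ 0 := fun t => by positivity
    fun_prop (disch := assumption)
  rw [← integral_one_div_one_add_sq_sq, integral_of_le (by linarith), ← integral_Icc_eq_integral_Ioc,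
    ofReal_integral_eq_lintegral_ofReal (hc.integrableOn_Icc)]
  exact Filter.Eventually.of_forall fun t => by positivity

/-! ### Orthonormal frames. -/

/-- Coordinates `(z, (x, y))` with respect to the frame `(u, e, v)`. -/
noncomputable def frameCoords (u e v : E3) (w : E3) : ℝ × ℝ × ℝ :=
  (inner ℝ u w, inner ℝ e w, inner ℝ v w)

lemma orthonormal_triple_iff {u e v : E3} :
    Orthonormal ℝ ![u, e, v] ↔ ‖u‖ = 1 ∧ ‖e‖ = 1 ∧ ‖v‖ = 1 ∧ inner ℝ u e = 0 ∧
      inner ℝ u v = 0 ∧ inner ℝ e v = 0 := by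
  simp only [Orthonormal, Pairwise, Fin.forall_fin_succ]
  simp [real_inner_comm]
  tauto

lemma exists_orthonormalBasis {u e v : E3} (h : Orthonormal ℝ ![u, e, v]) :
    ∃ b : OrthonormalBasis (Fin 3) ℝ E3, b 0 = u ∧ b 1 = e ∧ b 2 = v := by
  obtain ⟨b, hb⟩ := Orthonormal.exists_orthonormalBasis_extension_of_card_eq (𝕜 := ℝ) (E := E3)
    (ι := Fin 3) (by simp) (v := ![u, e, v]) (s := Set.univ)
    (h.comp (fun i : (Set.univ : Set (Fin 3)) => (i : Fin 3)) Subtype.val_injective)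
  exact ⟨b, hb 0 trivial, hb 1 trivial, hb 2 trivial⟩

lemma norm_sq_eq_frameCoords {u e v : E3} (h : Orthonormal ℝ ![u, e, v]) (w : E3) :
    ‖w‖ ^ 2 = inner ℝ u w ^ 2 + inner ℝ e w ^ 2 + inner ℝ v w ^ 2 := by
  obtain ⟨b, rfl, rfl, rfl⟩ := exists_orthonormalBasis h
  rw [← b.sum_sq_norm_inner_right w, Fin.sum_univ_three]
  simp

lemma measurePreserving_frameCoords {u e v : E3} (h : Orthonormal ℝ ![u, e, v]) :
    MeasurePreserving (frameCoords u e v) := by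
  obtain ⟨b, rfl, rfl, rfl⟩ := exists_orthonormalBasis h
  have h1 : MeasurePreserving (fun w => (b.repr w).ofLp) :=
    (PiLp.volume_preserving_ofLp (Fin 3)).comp b.measurePreserving_repr
  have h2 := (volume_preserving_piFinSuccAbove (fun _ : Fin 3 => ℝ) 0).comp h1
  have h3 := ((MeasurePreserving.id (volume : Measure ℝ)).prod
    (volume_preserving_finTwoArrow ℝ)).comp h2
  convert! h3 using 1
  funext w
  simp only [frameCoords, ← b.repr_apply_apply]
  rfl

lemma frameCoords_smul (u e v : E3) (t : ℝ) (w : E3) :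
    frameCoords u e v (t • w) = t • frameCoords u e v w := by
  simp [frameCoords, inner_smul_right]

lemma frameCoords_neg (u e v : E3) (w : E3) :
    frameCoords u e v (-w) = frameCoords (-u) (-e) (-v) w := by
  simp [frameCoords]

lemma measurable_frameCoords (u e v : E3) : Measurable (frameCoords u e v) := by
  unfold frameCoords; fun_prop

lemma lintegral_gaussian_frameCoords {u e v : E3} (h : Orthonormal ℝ ![u, e, v])
    {f : ℝ × ℝ × ℝ → ℝ} (hf : Measurable f) (hom : ∀ t : ℝ, 0 < t → ∀ p, f (t • p) = t * f p) :
    ∫⁻ w : E3, ENNReal.ofReal (f (frameCoords u e v w) * exp (-‖w‖ ^ 2)) =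
      ∫⁻ φ in Ioo (-π) π, ∫⁻ t : ℝ,
        ENNReal.ofReal (1 / (2 * (1 + t ^ 2) ^ 2)) * ENNReal.ofReal (f (t, cos φ, sin φ)) := by
  rw [← lintegral_gaussian_eq_lintegral_cylinder hf hom,
    ← (measurePreserving_frameCoords h).lintegral_comp (by fun_prop)]
  refine lintegral_congr fun w => ?_
  rw [norm_sq_eq_frameCoords h]
  rfl

/-! ### Integrating the support function circle by circle. -/

/-- The support function of the unit oloid, up to a translation. -/
noncomputable def unitSupport (p : ℝ × ℝ × ℝ) : ℝ :=
  max √(p.2.1 ^ 2 + p.2.2 ^ 2) (p.2.1 + √(p.2.1 ^ 2 + p.1 ^ 2))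

/-- The part of the support function that comes from the first circle. -/
noncomputable def firstPart (p : ℝ × ℝ × ℝ) : ℝ :=
  if √(p.2.1 ^ 2 + p.1 ^ 2) + p.2.1 ≤ √(p.2.1 ^ 2 + p.2.2 ^ 2) then
    √(p.2.1 ^ 2 + p.2.2 ^ 2) else 0

/-- The part of the support function that comes from the second circle, in the reflected frame. -/
noncomputable def secondPart (p : ℝ × ℝ × ℝ) : ℝ :=
  if √(p.2.1 ^ 2 + p.1 ^ 2) + p.2.1 < √(p.2.1 ^ 2 + p.2.2 ^ 2) then
    √(p.2.1 ^ 2 + p.2.2 ^ 2) - p.2.1 else 0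

/-- The second circle wins when `√(x² + z²) + x > √(x² + y²)`, that is `√(x² + y²) - x < √(x² +
z²)`: the first circle's condition, made strict, after swapping `y` and `z` and reversing `x`. -/
lemma unitSupport_eq_add (z x y : ℝ) :
    unitSupport (z, x, y) = firstPart (z, x, y) + secondPart (y, -x, z) := by
  simp only [unitSupport, firstPart, secondPart, neg_sq]
  rcases le_or_gt (√(x ^ 2 + z ^ 2) + x) √(x ^ 2 + y ^ 2) with h | h
  · rw [if_pos h, if_neg (by linarith), max_eq_left (by linarith), add_zero]
  · rw [if_neg (by linarith), if_pos (by linarith), max_eq_right (by linarith)]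
    ring

lemma sqrt_sq_add_sq_smul {t : ℝ} (ht : 0 < t) (a b : ℝ) :
    √((t * a) ^ 2 + (t * b) ^ 2) = t * √(a ^ 2 + b ^ 2) := by
  rw [show (t * a) ^ 2 + (t * b) ^ 2 = t ^ 2 * (a ^ 2 + b ^ 2) by ring,
    sqrt_mul (by positivity), sqrt_sq ht.le]

lemma unitSupport_smul {t : ℝ} (ht : 0 < t) (p : ℝ × ℝ × ℝ) :
    unitSupport (t • p) = t * unitSupport p := by
  simp only [unitSupport, Prod.smul_fst, Prod.smul_snd, smul_eq_mul, sqrt_sq_add_sq_smul ht,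
    mul_max_of_nonneg _ _ ht.le, mul_add]

lemma firstPart_smul {t : ℝ} (ht : 0 < t) (p : ℝ × ℝ × ℝ) :
    firstPart (t • p) = t * firstPart p := by
  simp only [firstPart, Prod.smul_fst, Prod.smul_snd, smul_eq_mul, sqrt_sq_add_sq_smul ht,
    ← mul_add, mul_le_mul_iff_right₀ ht, mul_ite, mul_zero]

lemma secondPart_smul {t : ℝ} (ht : 0 < t) (p : ℝ × ℝ × ℝ) :
    secondPart (t • p) = t * secondPart p := by
  simp only [secondPart, Prod.smul_fst, Prod.smul_snd, smul_eq_mul, sqrt_sq_add_sq_smul ht,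
    ← mul_add, ← mul_sub, mul_lt_mul_iff_right₀ ht, mul_ite, mul_zero]

lemma continuous_unitSupport : Continuous unitSupport := by unfold unitSupport; fun_prop

lemma measurable_firstPart : Measurable firstPart :=
  Measurable.ite (measurableSet_le (by fun_prop) (by fun_prop)) (by fun_prop) measurable_const

lemma measurable_secondPart : Measurable secondPart :=
  Measurable.ite (measurableSet_lt (by fun_prop) (by fun_prop)) (by fun_prop) measurable_const

lemma unitSupport_nonneg (p : ℝ × ℝ × ℝ) : 0 ≤ unitSupport p := le_max_of_le_left (sqrt_nonneg _)

lemma firstPart_nonneg (p : ℝ × ℝ × ℝ) : 0 ≤ firstPart p := by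
  unfold firstPart; split_ifs <;> positivity

lemma secondPart_nonneg (p : ℝ × ℝ × ℝ) : 0 ≤ secondPart p := by
  unfold secondPart
  split_ifs with h
  · linarith [sqrt_nonneg (p.2.1 ^ 2 + p.1 ^ 2)]
  · exact le_rfl

lemma sqrt_add_le_one_iff {t φ : ℝ} :
    √(cos φ ^ 2 + t ^ 2) + cos φ ≤ 1 ↔ t ^ 2 ≤ 1 - 2 * cos φ := by
  rw [← le_sub_iff_add_le, sqrt_le_left (by linarith [cos_le_one φ])]
  constructor <;> intro h <;> linarith

lemma sqrt_add_lt_one_iff {t φ : ℝ} (hφ : cos φ < 1) :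
    √(cos φ ^ 2 + t ^ 2) + cos φ < 1 ↔ t ^ 2 < 1 - 2 * cos φ := by
  rw [← lt_sub_iff_add_lt, sqrt_lt' (by linarith)]
  constructor <;> intro h <;> linarith

/-- `P` need only lie between the open and the closed interval, so the weak and the strict
inequality of the two parts are treated alike. -/
lemma lintegral_of_sq_le (S : ℝ) (c : ENNReal) (P : ℝ → Prop) [DecidablePred P]
    (h1 : ∀ t, P t → t ^ 2 ≤ S) (h2 : ∀ t, t ^ 2 < S → P t) :
    ∫⁻ t : ℝ, ENNReal.ofReal (1 / (2 * (1 + t ^ 2) ^ 2)) * (if P t then c else 0) =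
      ENNReal.ofReal (capIntegral √S / 2) * c := by
  rw [← lintegral_Icc_one_div_one_add_sq_sq (sqrt_nonneg S), ← lintegral_mul_const _ (by fun_prop),
    ← lintegral_indicator measurableSet_Icc]
  refine lintegral_congr_ae ?_
  have hne : ∀ a : ℝ, ∀ᵐ t : ℝ, t ≠ a := fun a => by simp [ae_iff]
  filter_upwards [hne √S, hne (-√S)] with t ht ht'
  by_cases hP : P t
  · rw [if_pos hP, indicator_of_mem (show t ∈ Icc (-√S) √S from abs_le.1 (abs_le_sqrt (h1 t hP)))]
  · rw [if_neg hP, mul_zero, indicator_of_notMem]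
    intro hm
    refine hP (h2 t ((lt_sqrt (abs_nonneg t)).1 (abs_lt.2 ⟨lt_of_le_of_ne hm.1 ht'.symm,
      lt_of_le_of_ne hm.2 ht⟩) |>.trans_eq' (sq_abs t)))

lemma lintegral_firstPart (φ : ℝ) :
    ∫⁻ t : ℝ, ENNReal.ofReal (1 / (2 * (1 + t ^ 2) ^ 2)) *
      ENNReal.ofReal (firstPart (t, cos φ, sin φ)) =
      ENNReal.ofReal (capIntegral √(1 - 2 * cos φ) / 2) := by
  rw [← mul_one (ENNReal.ofReal (capIntegral √(1 - 2 * cos φ) / 2)), ← lintegral_of_sq_le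
    (1 - 2 * cos φ) 1 (fun t => √(cos φ ^ 2 + t ^ 2) + cos φ ≤ 1)
    (fun t => sqrt_add_le_one_iff.1) (fun t h => sqrt_add_le_one_iff.2 h.le)]
  simp only [firstPart, cos_sq_add_sin_sq, sqrt_one, apply_ite ENNReal.ofReal, ENNReal.ofReal_one,
    ENNReal.ofReal_zero]

lemma lintegral_secondPart {φ : ℝ} (hφ : cos φ < 1) :
    ∫⁻ t : ℝ, ENNReal.ofReal (1 / (2 * (1 + t ^ 2) ^ 2)) *
      ENNReal.ofReal (secondPart (t, cos φ, sin φ)) =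
      ENNReal.ofReal (capIntegral √(1 - 2 * cos φ) / 2) * ENNReal.ofReal (1 - cos φ) := by
  rw [← lintegral_of_sq_le
    (1 - 2 * cos φ) _ (fun t => √(cos φ ^ 2 + t ^ 2) + cos φ < 1)
    (fun t h => ((sqrt_add_lt_one_iff hφ).1 h).le) (fun t => (sqrt_add_lt_one_iff hφ).2)]
  simp only [secondPart, cos_sq_add_sin_sq, sqrt_one, apply_ite ENNReal.ofReal,
    ENNReal.ofReal_zero]

lemma capIntegral_nonneg {s : ℝ} (hs : 0 ≤ s) : 0 ≤ capIntegral s := by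
  have := arctan_nonneg.2 hs
  unfold capIntegral; positivity

/-- Put `φ = π - ψ`. For `ψ` between `2π/3` and `4π/3` the radicand is nonpositive, so `Real.sqrt`
gives `0` and the integrand vanishes; the two outer pieces agree by `ψ ↦ 2π - ψ`. -/
lemma integral_profile_full_period :
    ∫ φ in (-π)..π, (2 - cos φ) * capIntegral √(1 - 2 * cos φ) =
      2 * ∫ ψ in (0 : ℝ)..(2 * π / 3), (2 + cos ψ) * capIntegral √(1 + 2 * cos ψ) := by
  set G : ℝ → ℝ := fun ψ => (2 + cos ψ) * capIntegral √(1 + 2 * cos ψ) with hG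
  have hca := continuous_capIntegral
  have hi : ∀ a b, IntervalIntegrable G volume a b := fun a b =>
    Continuous.intervalIntegrable (by fun_prop) a b
  have h1 : ∫ φ in (-π)..π, (2 - cos φ) * capIntegral √(1 - 2 * cos φ) = ∫ ψ in (0)..(2 * π), G ψ := by
    have := intervalIntegral.integral_comp_sub_left (a := -π) (b := π) G π
    simp only [hG, cos_pi_sub] at this
    rw [sub_self, sub_neg_eq_add, ← two_mul] at this
    rw [← this]
    simp only [mul_neg, ← sub_eq_add_neg]
  have h2 : ∫ ψ in (4 * π / 3)..(2 * π), G ψ = ∫ ψ in (0)..(2 * π / 3), G ψ := by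
    have := intervalIntegral.integral_comp_sub_left (a := 0) (b := 2 * π / 3) G (2 * π)
    simp only [hG, cos_two_pi_sub] at this
    rw [show 2 * π - 2 * π / 3 = 4 * π / 3 by ring, sub_zero] at this
    exact this.symm
  have h3 : ∫ ψ in (2 * π / 3)..(4 * π / 3), G ψ = 0 := by
    rw [integral_congr (g := fun _ => 0), intervalIntegral.integral_zero]
    intro ψ hψ
    rw [uIcc_of_le (by linarith [pi_pos])] at hψ
    have hc : cos ψ ≤ -(1 / 2) := by
      have h := cos_le_cos_of_nonneg_of_le_pi (abs_nonneg (ψ - π)) (y := π / 3)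
        (by linarith [pi_pos]) (abs_le.2 ⟨by linarith [hψ.1], by linarith [hψ.2]⟩)
      rw [cos_abs, cos_sub_pi, cos_pi_div_three] at h
      linarith
    have : √(1 + 2 * cos ψ) = 0 := sqrt_eq_zero_of_nonpos (by linarith)
    simp [hG, this, capIntegral]
  rw [h1, ← integral_add_adjacent_intervals (hi 0 (2 * π / 3)) (hi _ _),
    ← integral_add_adjacent_intervals (hi (2 * π / 3) (4 * π / 3)) (hi _ _), h2, h3]
  ring

lemma lintegral_gaussian_unitSupport {u e v : E3} (h : Orthonormal ℝ ![u, e, v]) :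
    ∫⁻ w : E3, ENNReal.ofReal (unitSupport (frameCoords u e v w) * exp (-‖w‖ ^ 2)) =
      ENNReal.ofReal (∫ ψ in (0 : ℝ)..(2 * π / 3), (2 + cos ψ) * capIntegral √(1 + 2 * cos ψ)) := by
  have h' : Orthonormal ℝ ![v, -e, u] := by
    rw [orthonormal_triple_iff] at h ⊢
    obtain ⟨h1, h2, h3, h4, h5, h6⟩ := h
    simp [h1, h2, h3, h4, h5, h6, real_inner_comm]
  have hm1 := measurable_frameCoords u e v
  have hm2 := measurable_frameCoords v (-e) u
  have hf1 := measurable_firstPart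
  have hf2 := measurable_secondPart
  have hca := continuous_capIntegral
  have hsplit : ∀ w, ENNReal.ofReal (unitSupport (frameCoords u e v w) * exp (-‖w‖ ^ 2)) =
      ENNReal.ofReal (firstPart (frameCoords u e v w) * exp (-‖w‖ ^ 2)) +
        ENNReal.ofReal (secondPart (frameCoords v (-e) u w) * exp (-‖w‖ ^ 2)) := by
    intro w
    have h1 := firstPart_nonneg (frameCoords u e v w)
    have h2 := secondPart_nonneg (frameCoords v (-e) u w)
    rw [← ENNReal.ofReal_add (by positivity) (by positivity), ← add_mul]
    simp only [frameCoords, unitSupport_eq_add, inner_neg_left]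
  simp_rw [hsplit]
  rw [lintegral_add_left (by fun_prop),
    lintegral_gaussian_frameCoords h measurable_firstPart (fun t ht => firstPart_smul ht),
    lintegral_gaussian_frameCoords h' measurable_secondPart (fun t ht => secondPart_smul ht)]
  simp_rw [lintegral_firstPart]
  rw [← lintegral_add_left (by fun_prop)]
  have hne : ∀ᵐ φ : ℝ, φ ≠ 0 := by simp [ae_iff]
  have hq : ∀ᵐ φ ∂volume.restrict (Ioo (-π) π), ENNReal.ofReal (capIntegral √(1 - 2 * cos φ) / 2) +
      ∫⁻ t : ℝ, ENNReal.ofReal (1 / (2 * (1 + t ^ 2) ^ 2)) *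
        ENNReal.ofReal (secondPart (t, cos φ, sin φ)) =
      ENNReal.ofReal (1 / 2 * ((2 - cos φ) * capIntegral √(1 - 2 * cos φ))) := by
    filter_upwards [ae_restrict_mem measurableSet_Ioo, ae_restrict_of_ae hne] with φ hφ h0
    have hc : cos φ < 1 := lt_of_le_of_ne (cos_le_one φ) fun hc =>
      h0 ((cos_eq_one_iff_of_lt_of_lt (by linarith [hφ.1, pi_pos]) (by linarith [hφ.2, pi_pos])).1 hc)
    have hn := capIntegral_nonneg (sqrt_nonneg (1 - 2 * cos φ))
    have hc' : 0 ≤ 1 - cos φ := by linarith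
    rw [lintegral_secondPart hc, ← ENNReal.ofReal_mul (by positivity),
      ← ENNReal.ofReal_add (by positivity) (by positivity)]
    congr 1
    ring
  rw [lintegral_congr_ae hq]
  have hint : ∫ φ in Ioo (-π) π, 1 / 2 * ((2 - cos φ) * capIntegral √(1 - 2 * cos φ)) =
      ∫ ψ in (0 : ℝ)..(2 * π / 3), (2 + cos ψ) * capIntegral √(1 + 2 * cos ψ) := by
    rw [← integral_Ioc_eq_integral_Ioo, ← integral_of_le (by linarith [pi_pos]),
      intervalIntegral.integral_const_mul, integral_profile_full_period]
    ring
  rw [← hint, ofReal_integral_eq_lintegral_ofReal]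
  · refine (Continuous.integrableOn_Icc (a := -π) (b := π) ?_).mono_set Ioo_subset_Icc_self
    fun_prop
  · refine Filter.Eventually.of_forall fun φ => ?_
    have hn := capIntegral_nonneg (sqrt_nonneg (1 - 2 * cos φ))
    have hc' : 0 ≤ 2 - cos φ := by linarith [cos_le_one φ]
    simp only [Pi.zero_apply]
    positivity

lemma integral_sphere_unitSupport {u e v : E3} (h : Orthonormal ℝ ![u, e, v]) :
    ∫ w : Metric.sphere (0 : E3) 1, unitSupport (frameCoords u e v w)
        ∂(volume : Measure E3).toSphere =
      2 * ∫ ψ in (0 : ℝ)..(2 * π / 3), (2 + cos ψ) * capIntegral √(1 + 2 * cos ψ) := by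
  have hm := measurable_frameCoords u e v
  have hu := continuous_unitSupport
  have h1 := lintegral_gaussian_unitSupport h
  rw [lintegral_gaussian_eq_lintegral_sphere (f := fun w => unitSupport (frameCoords u e v w))
    (by fun_prop) (fun t ht w => by rw [frameCoords_smul, unitSupport_smul ht])] at h1
  rw [integral_eq_lintegral_of_nonneg_ae (Filter.Eventually.of_forall fun w => unitSupport_nonneg _)
    (Measurable.aestronglyMeasurable (by fun_prop))]
  have h2 := congrArg ENNReal.toReal h1
  rw [ENNReal.toReal_mul, ENNReal.toReal_ofReal (by norm_num), ENNReal.toReal_ofReal] at h2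
  · linarith
  · refine intervalIntegral.integral_nonneg (by positivity) fun ψ _ => ?_
    have := capIntegral_nonneg (sqrt_nonneg (1 + 2 * cos ψ))
    have hc' : 0 ≤ 2 + cos ψ := by linarith [neg_one_le_cos ψ]
    positivity

/-! ### The support function of an oloid and the conclusion. -/

lemma norm_sub_inner_smul {n : E3} (hn : ‖n‖ = 1) (w : E3) :
    ‖w - inner ℝ n w • n‖ = √(‖w‖ ^ 2 - inner ℝ n w ^ 2) := by
  rw [eq_comm, sqrt_eq_iff_eq_sq _ (norm_nonneg _), norm_sub_sq_real, inner_smul_right,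
    norm_smul, hn, real_inner_comm, mul_one, norm_eq_abs, sq_abs]
  · ring
  · have := abs_real_inner_le_norm n w
    rw [hn, one_mul] at this
    linarith [sq_le_sq' (by linarith [abs_le.1 this, (abs_le.1 this).1]) (abs_le.1 this).2]

lemma inner_le_of_mem_circleInPlane {c n p w : E3} {r : ℝ} (hn : ‖n‖ = 1)
    (hp : p ∈ circleInPlane c n r) :
    inner ℝ p w ≤ inner ℝ c w + r * √(‖w‖ ^ 2 - inner ℝ n w ^ 2) := by
  have e : inner ℝ p w - inner ℝ c w = inner ℝ (p - c) (w - inner ℝ n w • n) := by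
    rw [inner_sub_right, inner_smul_right, hp.1, mul_zero, sub_zero, inner_sub_left]
  have h := real_inner_le_norm (p - c) (w - inner ℝ n w • n)
  rw [← dist_eq_norm, hp.2, norm_sub_inner_smul hn] at h
  linarith

lemma exists_mem_circleInPlane_inner_eq {c n : E3} {r : ℝ} (hn : ‖n‖ = 1) (hr : 0 ≤ r)
    (hne : (circleInPlane c n r).Nonempty) (w : E3) :
    ∃ p ∈ circleInPlane c n r,
      inner ℝ p w = inner ℝ c w + r * √(‖w‖ ^ 2 - inner ℝ n w ^ 2) := by
  rw [← norm_sub_inner_smul hn]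
  set w' := w - inner ℝ n w • n with hw'
  have horth : inner ℝ w' n = 0 := by
    rw [hw', inner_sub_left, inner_smul_left, real_inner_self_eq_norm_sq, hn, real_inner_comm]
    simp
  have e : ∀ q : E3, inner ℝ q n = 0 → inner ℝ q w = inner ℝ q w' := by
    intro q hq
    rw [hw', inner_sub_right, inner_smul_right, hq, mul_zero, sub_zero]
  -- If `w` is normal to the plane, every point of the circle is extremal, and nonemptiness supplies
  -- one.
  by_cases h0 : w' = 0
  · obtain ⟨p, hp⟩ := hne
    refine ⟨p, hp, ?_⟩
    have := e _ hp.1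
    rw [h0, inner_zero_right, inner_sub_left] at this
    rw [h0, norm_zero]
    linarith
  · have hpos : 0 < ‖w'‖ := norm_pos_iff.2 h0
    refine ⟨c + (r / ‖w'‖) • w', ⟨?_, ?_⟩, ?_⟩
    · rw [add_sub_cancel_left, inner_smul_left, horth, mul_zero]
    · rw [dist_eq_norm, add_sub_cancel_left, norm_smul, norm_eq_abs, abs_of_nonneg (by positivity)]
      field_simp
    · rw [inner_add_left, inner_smul_left, e w' horth, real_inner_self_eq_norm_sq]
      simp only [conj_trivial]
      field_simp

/-- A half-space containing both circles contains their hull, and Cauchy–Schwarz in each plane is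
attained along the projection of `w`. -/
lemma supportFn_convexHull_circles {A B u v : E3} {r : ℝ} (hr : 0 ≤ r) (hu : ‖u‖ = 1)
    (hv : ‖v‖ = 1) (hA : (circleInPlane A u r).Nonempty) (hB : (circleInPlane B v r).Nonempty)
    (w : E3) :
    supportFn (convexHull ℝ (circleInPlane A u r ∪ circleInPlane B v r)) w =
      max (inner ℝ A w + r * √(‖w‖ ^ 2 - inner ℝ u w ^ 2))
        (inner ℝ B w + r * √(‖w‖ ^ 2 - inner ℝ v w ^ 2)) := by
  set M := max (inner ℝ A w + r * √(‖w‖ ^ 2 - inner ℝ u w ^ 2))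
        (inner ℝ B w + r * √(‖w‖ ^ 2 - inner ℝ v w ^ 2)) with hM
  refine IsGreatest.csSup_eq ⟨?_, ?_⟩
  · have hsub := subset_convexHull ℝ (circleInPlane A u r ∪ circleInPlane B v r)
    rcases max_choice (inner ℝ A w + r * √(‖w‖ ^ 2 - inner ℝ u w ^ 2))
        (inner ℝ B w + r * √(‖w‖ ^ 2 - inner ℝ v w ^ 2)) with h | h
    · obtain ⟨p, hp, e⟩ := exists_mem_circleInPlane_inner_eq hu hr hA w
      exact ⟨p, hsub (Or.inl hp), by rw [hM, h]; exact e⟩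
    · obtain ⟨p, hp, e⟩ := exists_mem_circleInPlane_inner_eq hv hr hB w
      exact ⟨p, hsub (Or.inr hp), by rw [hM, h]; exact e⟩
  · rintro _ ⟨p, hp, rfl⟩
    have hconv : Convex ℝ {p : E3 | inner ℝ p w ≤ M} := by
      have := convex_halfSpace_le (𝕜 := ℝ) (f := fun p : E3 => (inner ℝ p w : ℝ))
        ⟨fun x y => inner_add_left x y w, fun c x => by simp [inner_smul_left]⟩ M
      exact this
    refine convexHull_min ?_ hconv hp
    rintro q (hq | hq)
    · exact (inner_le_of_mem_circleInPlane hu hq).trans (le_max_left _ _)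
    · exact (inner_le_of_mem_circleInPlane hv hq).trans (le_max_right _ _)

lemma exists_frame_of_isOloid {r : ℝ} (hr : 0 < r) {Ω : Set E3} (hΩ : IsOloid r Ω) :
    ∃ A u e v : E3, Orthonormal ℝ ![u, e, v] ∧
      ∀ w, supportFn Ω w = inner ℝ A w + r * unitSupport (frameCoords u e v w) := by
  obtain ⟨A, B, u, v, hu, hv, huv, hB, hA, rfl⟩ := hΩ
  set e : E3 := r⁻¹ • (B - A) with he
  have hBA : B - A = r • e := by rw [he, smul_inv_smul₀ hr.ne']
  have hnorm : ‖e‖ = 1 := by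
    rw [he, norm_smul, ← dist_eq_norm, hB.2, norm_inv, norm_eq_abs, abs_of_pos hr,
      inv_mul_cancel₀ hr.ne']
  have hue : inner ℝ u e = 0 := by
    rw [real_inner_comm, he, inner_smul_left, hB.1, mul_zero]
  have hev : inner ℝ e v = 0 := by
    have := hA.1
    rw [← neg_sub, inner_neg_left, neg_eq_zero] at this
    rw [he, inner_smul_left, this, mul_zero]
  have horth : Orthonormal ℝ ![u, e, v] :=
    orthonormal_triple_iff.2 ⟨hu, hnorm, hv, hue, huv, hev⟩
  refine ⟨A, u, e, v, horth, fun w => ?_⟩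
  rw [supportFn_convexHull_circles hr.le hu hv ⟨B, hB⟩ ⟨A, hA⟩, norm_sq_eq_frameCoords horth]
  have hBw : inner ℝ B w = inner ℝ A w + r * inner ℝ e w := by
    have : inner ℝ (B - A) w = r * inner ℝ e w := by rw [hBA, inner_smul_left]; simp
    rw [inner_sub_left] at this
    linarith
  rw [hBw, add_assoc (inner ℝ A w), max_add_add_left, ← mul_add, ← mul_max_of_nonneg _ _ hr.le, unitSupport,
    frameCoords]
  simp only
  congr 4 <;> ring_nf

lemma volume_toSphere_univ : (volume : Measure E3).toSphere.real univ = 4 * π := by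
  rw [Measure.toSphere_real_apply_univ, measureReal_def, EuclideanSpace.volume_ball_fin_three]
  simp
  rw [ENNReal.toReal_ofReal (by positivity)]
  ring

lemma integrable_unitSupport_sphere (u e v : E3) :
    Integrable (fun w : Metric.sphere (0 : E3) 1 => unitSupport (frameCoords u e v w))
      (volume : Measure E3).toSphere := by
  have h1 := continuous_unitSupport
  have h2 : Continuous (frameCoords u e v) := by unfold frameCoords; fun_prop
  have hc : Continuous fun w : Metric.sphere (0 : E3) 1 => unitSupport (frameCoords u e v w) := by
    fun_prop
  exact hc.integrable_of_hasCompactSupport (HasCompactSupport.of_compactSpace _)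

lemma meanWidth_of_isOloid {r : ℝ} (hr : 0 < r) {Ω : Set E3} (hΩ : IsOloid r Ω) :
    meanWidth Ω = (3 / (2 * π) * ellipticK (√3 / 2) + 3 * π / 4 - 2 / π * oloidI) * r := by
  obtain ⟨A, u, e, v, h, hs⟩ := exists_frame_of_isOloid hr hΩ
  -- The value at `-w` is `unitSupport` in the negated frame, so both halves of the width have the
  -- same integral.
  have h' : Orthonormal ℝ ![-u, -e, -v] := by
    rw [orthonormal_triple_iff] at h ⊢
    simpa using h
  have hw : ∀ w : E3, widthIn Ω w = r * (unitSupport (frameCoords u e v w) +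
      unitSupport (frameCoords (-u) (-e) (-v) w)) := by
    intro w
    rw [widthIn, hs, hs, frameCoords_neg, inner_neg_right]
    ring
  rw [meanWidth, average_eq, volume_toSphere_univ]
  simp_rw [hw]
  rw [MeasureTheory.integral_const_mul, MeasureTheory.integral_add (integrable_unitSupport_sphere _ _ _)
    (integrable_unitSupport_sphere _ _ _), integral_sphere_unitSupport h,
    integral_sphere_unitSupport h', integral_oloid_profile, smul_eq_mul]
  have := pi_pos
  field_simp
  ring

end Oloid

theorem theorem1 (r : ℝ) (hr : 0 < r) (Ω : Set E3) (hΩ : IsOloid r Ω) :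
    meanWidth Ω =
      (3 / (2 * Real.pi) * ellipticK (Real.sqrt 3 / 2) + 3 * Real.pi / 4
        - 2 / Real.pi * oloidI) * r ∧
    |meanWidth Ω - 2.19067696623158876633263049436 * r| ≤ 1 / 2 * (1 / 10 ^ 29) * r := by
  refine ⟨Oloid.meanWidth_of_isOloid hr hΩ, ?_⟩
  rw [Oloid.meanWidth_of_isOloid hr hΩ, ← sub_mul, abs_mul, abs_of_pos hr]
  exact mul_le_mul_of_nonneg_right Oloid.oloid_coefficient_bounds hr.le
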